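/- For $t\in\mathbb R$ let $\mathrm{sgn}(t)=-1$ if $t<0$ and $\mathrm{sgn}(t)=1$ otherwise. For a real polynomial $p$ in finitely many variables indexed by $V$, let $\widehat p_S=\mathbf E_{x}[p(x)\prod_{i\in S}x_i]$ ($x$ uniform on $\{-1,1\}^V$), $\mathrm{Inf}_i(p)=\sum_{S\ni i}\widehat p_S^{\,2}$ and $\mathrm{Inf}(p)=\sum_i\mathrm{Inf}_i(p)$; $p$ is called $\tau$-regular if $\mathrm{Inf}_i(p)\le\tau\,\mathrm{Inf}(p)$ for all $i$. A distribution on $\{-1,1\}^V$ is $k$-wise independent if its projection to every set of at most $k$ coordinates is uniform. Theorem. There are universal constants $C,K\in\mathbb N$ such that the following holds for all $d,n\in\mathbb N$, every real polynomial $p$ in $n$ variables of degree at most $d$, and every $\tau>0$. There is a decision tree $\mathcal T$ that queries variables at its internal nodes (no variable twice on a path), with each leaf $\rho$ labelled by a polynomial $p_\rho$ in the variables not queried on the path to $\rho$, such that: 1. the depth of $\mathcal T$ is at most $\frac1\tau\cdot\big(\max\{2,\,d\log_2(1/\tau)\}\big)^{Cd}$ (for $d\ge1$ and $\tau\le 1/4$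 the maximum is $d\log_2(1/\tau)$); 2. $\mathcal T$ computes $f=\mathrm{sgn}(p)$: for every $x\in\{-1,1\}^n$, if $x$ leads to the leaf $\rho$ then $f(x)=\mathrm{sgn}(p_\rho(x'))$, where $x'$ is the restriction of $x$ to the variables not queried on the path to $\rho$; 3. each $p_\rho$ is the polynomial obtained from $p$ by fixing the variables queried on the path to $\rho$ to their values on that path; in particular it has degree at most $d$; 4. with probability at least $1-\tau$, the uniform random walk from the root of $\mathcal T$ reaches a leaf $\rho$ such that either (i) $p_\rho$ is $\tau$-regular, so that $f_\rho=\mathrm{sgn}(p_\rho)$ is a $\tau$-regular degree-$d$ PTF, or (ii) for every integer $k\ge K\,d\log_2(1/\tau)$ and every $k$-wise independent distribution $\mathcal D'$ over the cube of the variables not queried on the path to $\rho$, there is $b\in\{-1,1\}$ with $\Pr_{x\sim\mathcal D'}[f_\rho(x)\neq b]\le\tau$. -/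

import Mathlib

namespace KWisePTF

noncomputable section

/-- The hypercube `{-1,1}^V`; the units of `ℤ` are exactly `1` and `-1`. -/
abbrev Cube (V : Type) : Type := V → ℤˣ

/-- `sgn` is `-1` on negative arguments and `1` otherwise. -/
def sgn (t : ℝ) : ℤˣ := if t < 0 then -1 else 1

/-- The value of a real polynomial at a point of the hypercube. -/
def evalCube {V : Type} (p : MvPolynomial V ℝ) (x : Cube V) : ℝ :=
  MvPolynomial.eval (fun i => ((x i : ℤ) : ℝ)) p

/-- The polynomial threshold function `x ↦ sgn (p x)`. -/
def ptf {V : Type} (p : MvPolynomial V ℝ) (x : Cube V) : ℤˣ := sgn (evalCube p x)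

/-- The Fourier-Walsh coefficient `𝔼_x [p(x) ∏_{i ∈ S} x_i]`, with `x` uniform on the cube. -/
def walshCoeff {V : Type} [Fintype V] [DecidableEq V] (p : MvPolynomial V ℝ)
    (S : Finset V) : ℝ :=
  (∑ x : Cube V, evalCube p x * ∏ i ∈ S, ((x i : ℤ) : ℝ)) / 2 ^ Fintype.card V

/-- The influence of the variable `i` on `p`. -/
def influence {V : Type} [Fintype V] [DecidableEq V] (p : MvPolynomial V ℝ) (i : V) : ℝ :=
  ∑ S : Finset V with i ∈ S, walshCoeff p S ^ 2

/-- The total influence of `p`. -/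
def totalInfluence {V : Type} [Fintype V] [DecidableEq V] (p : MvPolynomial V ℝ) : ℝ :=
  ∑ i : V, influence p i

/-- `p` is `τ`-regular: no variable has more than a `τ` fraction of the total influence. -/
def IsRegular {V : Type} [Fintype V] [DecidableEq V] (τ : ℝ) (p : MvPolynomial V ℝ) : Prop :=
  ∀ i : V, influence p i ≤ τ * totalInfluence p

/-- The probability of the event `E` under the distribution `D` on the cube. -/
def prob {V : Type} (D : PMF (Cube V)) (E : Set (Cube V)) : ℝ := (D.toOuterMeasure E).toReal

/-- `D` is `k`-wise independent: its projection to any set of at most `k` coordinates is uniform.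
(For `k ≤ |V|` it is the same to ask this for sets of exactly `k` coordinates; for `k ≥ |V|` it
says that `D` is uniform.) -/
def IsKWiseIndependent {V : Type} (k : ℕ) (D : PMF (Cube V)) : Prop :=
  ∀ S : Finset V, S.card ≤ k → ∀ a : Cube V,
    prob D {x | ∀ i ∈ S, x i = a i} = (1 / 2 : ℝ) ^ S.card

/-- Under every `k`-wise independent distribution, `f` is `τ`-close to a constant `b ∈ {-1,1}`. -/
def IsCloseToConstUnderKWise {V : Type} (k : ℕ) (τ : ℝ) (f : Cube V → ℤˣ) : Prop :=
  ∀ D : PMF (Cube V), IsKWiseIndependent k D → ∃ b : ℤˣ, prob D {x | f x ≠ b} ≤ τ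

/-- A decision tree whose not yet queried variables are those in `S`. An internal node queries a
variable `i ∈ S` (so no variable is queried twice on a path) and branches on its value `-1` or `1`;
a leaf is labelled with a polynomial in the variables that were not queried on its path. -/
inductive DTree (n : ℕ) : Finset (Fin n) → Type
  | leaf {S : Finset (Fin n)} (q : MvPolynomial {j // j ∈ S} ℝ) : DTree n S
  | node {S : Finset (Fin n)} (i : Fin n) (hi : i ∈ S)
      (neg pos : DTree n (S.erase i)) : DTree n S

namespace DTree

variable {n : ℕ}

/-- The largest number of queries on a path from the root to a leaf. -/
def depth : {S : Finset (Fin n)} → DTree n S → ℕ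
  | _, leaf _ => 0
  | _, node _ _ neg pos => max neg.depth pos.depth + 1

/-- The leaf reached by the input `x`: its set of unqueried variables and its label. -/
def leafAt : {S : Finset (Fin n)} → DTree n S → Cube (Fin n) →
    (R : Finset (Fin n)) × MvPolynomial {j // j ∈ R} ℝ
  | S, leaf q, _ => ⟨S, q⟩
  | _, node i _ neg pos, x => if x i = -1 then neg.leafAt x else pos.leafAt x

/-- The Boolean function computed by the tree: walk to the leaf reached by `x` and apply there the
PTF of its label to the unqueried variables. -/
def eval {S : Finset (Fin n)} (T : DTree n S) (x : Cube (Fin n)) : ℤˣ :=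
  ptf (T.leafAt x).2 (fun j => x j)

open Classical in
/-- The probability that the uniform random walk from the root, which takes either branch of each
internal node with probability `1/2`, ends in a leaf with the property `P`. -/
def walkProb (P : (R : Finset (Fin n)) → MvPolynomial {j // j ∈ R} ℝ → Prop) :
    {S : Finset (Fin n)} → DTree n S → ℝ
  | S, leaf q => if P S q then 1 else 0
  | _, node _ _ neg pos => (neg.walkProb P + pos.walkProb P) / 2

end DTree

/-- The restriction of `p` in which every variable outside `R` is fixed as in `x`, as a polynomial
in the variables in `R`. -/
def restrict {n : ℕ} (p : MvPolynomial (Fin n) ℝ) (R : Finset (Fin n)) (x : Cube (Fin n)) :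
    MvPolynomial {j // j ∈ R} ℝ :=
  MvPolynomial.bind₁
    (fun j => if h : j ∈ R then MvPolynomial.X ⟨j, h⟩ else MvPolynomial.C ((x j : ℤ) : ℝ)) p

end

end KWisePTF

/-! Fix a threshold τ' much smaller than τ. In the current restriction f of `p`, keep moving into a
head H any coordinate whose influence exceeds a τ' fraction of the total influence outside H. Each
move shrinks that total by a factor 1 - τ', so after at most m moves either no coordinate outside H
dominates, or the influence left outside H is negligible compared with 𝔼 f² (`exists_greedy_head`).

Querying H then gives a good leaf with probability at least δ = 1/(32·9^d). If no coordinate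
dominates, the restricted influences have the old influences as means and hypercontractively bounded
moments. A high moment summed over coordinates keeps every one of them small, without a union bound
over n, and Paley-Zygmund keeps their total large (`LowDegree.pr_regular`). If little influence is
left, Poincaré makes the restricted variance tiny on average, while Paley-Zygmund makes the squared
mean large (`LowDegree.pr_variance_le`). The centred polynomial to the power 2r then has degree at
most 2rd, so bounded independence computes its mean exactly, and Markov's inequality shows that the
sign is nearly constant (`isCloseToConst_of_variance_le`).

A leaf that is not good starts another round (`hasTree_iterate`). About 9^d log(1/τ) rounds bring
the failure probability below τ, each at the cost of at most m queries. -/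

namespace KWisePTF

noncomputable section

open Finset
open scoped BigOperators

set_option linter.unusedSectionVars false

variable {V : Type} [Fintype V] [DecidableEq V]

/-! ### Fourier analysis on the cube -/

/-- The Walsh character `∏ i ∈ S, x i`. -/
def chi (S : Finset V) (x : Cube V) : ℝ := ∏ i ∈ S, ((x i : ℤ) : ℝ)

/-- The point `x` with the sign of coordinate `i` flipped. -/
def flip (i : V) (x : Cube V) : Cube V := Function.update x i (-x i)

/-- The Fourier-Walsh coefficient of a function on the cube. -/
def fourierCoeff (f : Cube V → ℝ) (S : Finset V) : ℝ := 𝔼 x, f x * chi S x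

/-- The part of `f` that changes sign with coordinate `i`. -/
def lap (i : V) (f : Cube V → ℝ) (x : Cube V) : ℝ := (f x - f (flip i x)) / 2

/-- The influence of coordinate `i` on a function on the cube. -/
def inf (f : Cube V → ℝ) (i : V) : ℝ := 𝔼 x, lap i f x ^ 2

/-- All Fourier-Walsh coefficients of `f` above level `d` vanish. -/
def LowDegree (d : ℕ) (f : Cube V → ℝ) : Prop := ∀ S : Finset V, d < S.card → fourierCoeff f S = 0

lemma card_cube : Fintype.card (Cube V) = 2 ^ Fintype.card V := by simp [Cube]

lemma expect_cube (f : Cube V → ℝ) : 𝔼 x, f x = (∑ x, f x) / 2 ^ Fintype.card V := by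
  rw [Fintype.expect_eq_sum_div_card, card_cube]; norm_cast

lemma unit_cast_mul_self (u : ℤˣ) : ((u : ℤ) : ℝ) * ((u : ℤ) : ℝ) = 1 := by
  rcases Int.units_eq_one_or u with h | h <;> simp [h]

lemma flip_flip (i : V) (x : Cube V) : flip i (flip i x) = x := by
  simp [flip]

lemma expect_flip (i : V) (f : Cube V → ℝ) : 𝔼 x, f (flip i x) = 𝔼 x, f x :=
  Fintype.expect_equiv (Function.Involutive.toPerm _ (flip_flip i)) _ _ fun _ => rfl

lemma chi_flip_of_notMem {S : Finset V} {i : V} (h : i ∉ S) (x : Cube V) :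
    chi S (flip i x) = chi S x := by
  refine prod_congr rfl fun j hj => ?_
  rw [flip, Function.update_of_ne (ne_of_mem_of_not_mem hj h)]

lemma chi_insert {S : Finset V} {i : V} (h : i ∉ S) (x : Cube V) :
    chi (insert i S) x = ((x i : ℤ) : ℝ) * chi S x := prod_insert h

lemma chi_flip_of_mem {S : Finset V} {i : V} (h : i ∈ S) (x : Cube V) :
    chi S (flip i x) = -chi S x := by
  rw [← insert_erase h, chi_insert (by simp), chi_insert (by simp),
    chi_flip_of_notMem (by simp)]
  simp [flip]

lemma expect_chi (S : Finset V) : 𝔼 x, chi S x = if S = ∅ then 1 else 0 := by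
  split_ifs with h
  · subst h; simp [chi]
  · obtain ⟨i, hi⟩ := Finset.nonempty_iff_ne_empty.mpr h
    have := expect_flip i (chi S)
    simp only [chi_flip_of_mem hi, expect_neg_distrib] at this
    linarith

/-- The sum factors as ∏ (1 + x_i y_i), and any disagreement makes a factor vanish. -/
lemma sum_chi_mul_chi (x y : Cube V) :
    ∑ S : Finset V, chi S x * chi S y = if x = y then 2 ^ Fintype.card V else 0 := by
  have h1 : ∑ S : Finset V, chi S x * chi S y
      = ∏ i : V, (1 + ((x i : ℤ) : ℝ) * ((y i : ℤ) : ℝ)) := by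
    rw [prod_one_add, powerset_univ]
    exact sum_congr rfl fun S _ => by simp [chi, prod_mul_distrib]
  rw [h1]
  split_ifs with h
  · subst h
    simp [unit_cast_mul_self]; norm_num
  · obtain ⟨i, hi⟩ := Function.ne_iff.mp h
    refine prod_eq_zero (mem_univ i) ?_
    rcases Int.units_eq_one_or (x i) with hx | hx <;>
      rcases Int.units_eq_one_or (y i) with hy | hy <;> simp_all

lemma fourier_inversion (f : Cube V → ℝ) (x : Cube V) :
    f x = ∑ S : Finset V, fourierCoeff f S * chi S x := by
  simp only [fourierCoeff, expect_cube, div_mul_eq_mul_div, sum_mul]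
  rw [← sum_div, sum_comm]
  simp only [mul_assoc, ← mul_sum, sum_chi_mul_chi]
  simp

lemma parseval (f : Cube V → ℝ) : ∑ S : Finset V, fourierCoeff f S ^ 2 = 𝔼 x, f x ^ 2 := by
  have h : ∀ x, f x ^ 2 = ∑ S : Finset V, fourierCoeff f S * (f x * chi S x) := fun x => by
    rw [sq]; nth_rewrite 2 [fourier_inversion f x]
    rw [mul_sum]; exact sum_congr rfl fun S _ => by ring
  simp_rw [h]
  rw [expect_sum_comm]
  refine sum_congr rfl fun S _ => ?_
  rw [← mul_expect, sq]; rfl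

/-- Flipping coordinate i preserves the uniform measure and negates exactly the characters
containing i. -/
lemma fourierCoeff_lap (i : V) (f : Cube V → ℝ) (S : Finset V) :
    fourierCoeff (lap i f) S = if i ∈ S then fourierCoeff f S else 0 := by
  have h := expect_flip i (fun x => f x * chi S (flip i x))
  simp only [flip_flip] at h
  have h2 : fourierCoeff (lap i f) S
      = (𝔼 x, f x * chi S x - 𝔼 x, f (flip i x) * chi S x) / 2 := by
    rw [fourierCoeff, ← expect_sub_distrib, expect_div]
    exact expect_congr rfl fun x _ => by simp only [lap]; ring
  rw [h2, h]
  split_ifs with hi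
  · simp only [chi_flip_of_mem hi, mul_neg, expect_neg_distrib, fourierCoeff]; ring
  · simp only [chi_flip_of_notMem hi, sub_self, zero_div]

/-- Links the two views of influence: the second moment behaves well under restriction and
hypercontractivity, the Fourier sum matches the stated definition. -/
lemma inf_eq_sum (f : Cube V → ℝ) (i : V) :
    inf f i = ∑ S : Finset V with i ∈ S, fourierCoeff f S ^ 2 := by
  rw [inf, ← parseval, sum_filter]
  exact sum_congr rfl fun S _ => by rw [fourierCoeff_lap]; split_ifs <;> simp

lemma inf_nonneg (f : Cube V → ℝ) (i : V) : 0 ≤ inf f i :=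
  expect_nonneg fun _ _ => sq_nonneg _

lemma sum_inf (f : Cube V → ℝ) :
    ∑ i, inf f i = ∑ S : Finset V, (S.card : ℝ) * fourierCoeff f S ^ 2 := by
  simp_rw [inf_eq_sum, sum_filter]
  rw [sum_comm]
  refine sum_congr rfl fun S _ => ?_
  rw [← sum_filter, sum_const, nsmul_eq_mul]
  simp

lemma LowDegree.lowDegree_lap {d : ℕ} {f : Cube V → ℝ} (hf : LowDegree d f) (i : V) :
    LowDegree d (lap i f) := fun S hS => by
  rw [fourierCoeff_lap, hf S hS, ite_self]

lemma sum_inf_le {d : ℕ} {f : Cube V → ℝ} (hf : LowDegree d f) :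
    ∑ i, inf f i ≤ d * 𝔼 x, f x ^ 2 := by
  rw [sum_inf, ← parseval, mul_sum]
  refine sum_le_sum fun S _ => ?_
  by_cases h : d < S.card
  · simp [hf S h]
  · have : (S.card : ℝ) ≤ d := by exact_mod_cast not_lt.mp h
    gcongr

/-- The Poincaré inequality on the cube. -/
lemma poincare (f : Cube V → ℝ) : 𝔼 x, f x ^ 2 - (𝔼 x, f x) ^ 2 ≤ ∑ i, inf f i := by
  rw [sum_inf, ← parseval]
  have h0 : 𝔼 x, f x = fourierCoeff f ∅ := by simp [fourierCoeff, chi]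
  rw [h0, ← add_sum_erase _ _ (mem_univ ∅), ← add_sum_erase _ _ (mem_univ (∅ : Finset V))]
  simp only [card_empty, Nat.cast_zero, zero_mul, zero_add, add_sub_cancel_left]
  refine sum_le_sum fun S hS => ?_
  have : (1 : ℝ) ≤ S.card := by
    exact_mod_cast card_pos.mpr (nonempty_iff_ne_empty.mpr (ne_of_mem_erase hS))
  nlinarith [sq_nonneg (fourierCoeff f S)]

/-! ### Hypercontractivity -/

/-- From j to j + 1 the left side grows by (r-j)/(j+1) · (2r-2j-1)/(2j+1), and the last fraction is
at most 2r-1, the extra factor gained on the right. -/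
lemma choose_two_mul_le (r j : ℕ) :
    ((2 * r).choose (2 * j) : ℝ) ≤ (2 * r - 1) ^ j * (r.choose j : ℝ) := by
  induction j with
  | zero => simp
  | succ j ih =>
    rcases Nat.lt_or_ge r (j + 1) with h | h
    · simp [Nat.choose_eq_zero_of_lt h, Nat.choose_eq_zero_of_lt (show 2 * r < 2 * (j + 1) by omega)]
    have hr : (j : ℝ) + 1 ≤ r := by exact_mod_cast h
    have e1 : ((2 * r).choose (2 * j + 1) : ℝ) * (2 * j + 1)
        = (2 * r).choose (2 * j) * (2 * r - 2 * j) := by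
      have := congrArg (Nat.cast (R := ℝ)) (Nat.choose_succ_right_eq (2 * r) (2 * j))
      push_cast [Nat.cast_sub (show 2 * j ≤ 2 * r by omega)] at this
      exact this
    have e2 : ((2 * r).choose (2 * (j + 1)) : ℝ) * (2 * j + 2)
        = (2 * r).choose (2 * j + 1) * (2 * r - 2 * j - 1) := by
      have := congrArg (Nat.cast (R := ℝ)) (Nat.choose_succ_right_eq (2 * r) (2 * j + 1))
      push_cast [Nat.cast_sub (show 2 * j + 1 ≤ 2 * r by omega)] at this
      rw [show 2 * (j + 1) = 2 * j + 1 + 1 by ring]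
      linarith
    have e3 : (r.choose (j + 1) : ℝ) * (j + 1) = r.choose j * (r - j) := by
      have := congrArg (Nat.cast (R := ℝ)) (Nat.choose_succ_right_eq r j)
      push_cast [Nat.cast_sub (show j ≤ r by omega)] at this
      exact this
    have hj : (0 : ℝ) ≤ j := j.cast_nonneg
    have key : ((2 * r).choose (2 * (j + 1)) : ℝ) * ((2 * j + 1) * (j + 1))
        ≤ (2 * r - 1) ^ (j + 1) * (r.choose (j + 1) : ℝ) * ((2 * j + 1) * (j + 1)) := by
      calc ((2 * r).choose (2 * (j + 1)) : ℝ) * ((2 * j + 1) * (j + 1))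
          = (2 * r).choose (2 * j) * ((r - j) * (2 * r - 2 * j - 1)) := by
            linear_combination (2 * j + 1) / 2 * e2 + (2 * r - 2 * j - 1) / 2 * e1
        _ ≤ (2 * r - 1) ^ j * (r.choose j : ℝ) * ((r - j) * ((2 * r - 1) * (2 * j + 1))) := by
            have hA : (2 * r - 2 * j - 1 : ℝ) ≤ (2 * r - 1) * (2 * j + 1) := by nlinarith
            have hB : (0 : ℝ) ≤ 2 * r - 2 * j - 1 := by linarith
            have hC : (0 : ℝ) ≤ r - j := by linarith
            have hD : (0 : ℝ) ≤ 2 * r - 1 := by linarith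
            gcongr
        _ = _ := by
            linear_combination -(2 * r - 1) ^ j * (2 * r - 1) * (2 * j + 1) * e3
    exact le_of_mul_le_mul_right key (by positivity)

/-- Odd powers of h cancel, and the even terms are dominated one by one by the binomial expansion on
the right. -/
lemma two_point_inequality (r : ℕ) (g h : ℝ) :
    ((g + h) ^ (2 * r) + (g - h) ^ (2 * r)) / 2 ≤ (g ^ 2 + (2 * r - 1) * h ^ 2) ^ r := by
  have e : ((g + h) ^ (2 * r) + (g - h) ^ (2 * r)) / 2
      = ∑ k ∈ range (2 * r + 1), if Even k then h ^ k * g ^ (2 * r - k) * (2 * r).choose k else 0 := by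
    rw [sub_eq_add_neg, add_comm g h, add_comm g (-h), add_pow, add_pow, ← sum_add_distrib,
      sum_div]
    refine sum_congr rfl fun k _ => ?_
    split_ifs with hk
    · rw [hk.neg_pow]; ring
    · rw [(Nat.not_even_iff_odd.mp hk).neg_pow]; ring
  rw [e, ← sum_filter, add_comm (g ^ 2), add_pow]
  have e2 : (range (2 * r + 1)).filter Even = (range (r + 1)).image (2 * ·) := by
    ext k
    simp only [mem_filter, mem_range, mem_image]
    constructor
    · rintro ⟨h1, m, rfl⟩; exact ⟨m, by omega, by ring⟩
    · rintro ⟨m, h1, rfl⟩; exact ⟨by omega, by simp⟩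
  rw [e2, sum_image (by intro a _ b _ h; simpa using h)]
  refine sum_le_sum fun j hj => ?_
  have hj' : j ≤ r := by simpa [Nat.lt_succ_iff] using hj
  have h1 : h ^ (2 * j) * g ^ (2 * r - 2 * j) = (h ^ 2) ^ j * (g ^ 2) ^ (r - j) := by
    rw [← pow_mul, ← pow_mul, Nat.mul_sub]
  rw [h1, mul_pow]
  have := mul_le_mul_of_nonneg_left (choose_two_mul_le r j)
    (show 0 ≤ (h ^ 2) ^ j * (g ^ 2) ^ (r - j) by positivity)
  linarith

/-- Minkowski's inequality for powers of nonnegative functions. -/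
lemma expect_add_pow_le {ι : Type*} [Fintype ι] {r : ℕ} {u v : ι → ℝ} {a b : ℝ}
    (hr : r ≠ 0) (hu : ∀ x, 0 ≤ u x) (hv : ∀ x, 0 ≤ v x) (ha : 0 ≤ a) (hb : 0 ≤ b)
    (hua : 𝔼 x, u x ^ r ≤ a ^ r) (hvb : 𝔼 x, v x ^ r ≤ b ^ r) :
    𝔼 x, (u x + v x) ^ r ≤ (a + b) ^ r := by
  have zero : ∀ w : ι → ℝ, (∀ x, 0 ≤ w x) → 𝔼 x, w x ^ r ≤ (0 : ℝ) ^ r → ∀ x, w x = 0 := by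
    intro w hw h x
    rw [zero_pow hr] at h
    have h' := le_antisymm h (expect_nonneg fun x _ => pow_nonneg (hw x) r)
    rw [expect_eq_zero_iff_of_nonneg fun x _ => pow_nonneg (hw x) r] at h'
    exact pow_eq_zero_iff hr |>.mp (h' x (mem_univ x))
  rcases ha.eq_or_lt with rfl | ha
  · simpa [zero u hu hua] using hvb
  rcases hb.eq_or_lt with rfl | hb
  · simpa [zero v hv hvb] using hua
  -- Convexity of t ↦ t^r at the points u/a and v/b with weights a/(a+b) and b/(a+b); the cases a =
  -- 0 and b = 0 had to be removed for this.
  have hpt : ∀ x, (u x + v x) ^ r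
      ≤ (a + b) ^ r * (a / (a + b) * (u x ^ r / a ^ r) + b / (a + b) * (v x ^ r / b ^ r)) := by
    intro x
    have := (convexOn_pow r).2 (show u x / a ∈ Set.Ici (0 : ℝ) from div_nonneg (hu x) ha.le)
      (show v x / b ∈ Set.Ici (0 : ℝ) from div_nonneg (hv x) hb.le)
      (show 0 ≤ a / (a + b) by positivity) (show 0 ≤ b / (a + b) by positivity) (by field_simp)
    simp only [smul_eq_mul] at this
    rw [show a / (a + b) * (u x / a) + b / (a + b) * (v x / b) = (u x + v x) / (a + b) by
      field_simp, div_pow, div_pow, div_pow, div_le_iff₀ (by positivity)] at this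
    linarith
  calc 𝔼 x, (u x + v x) ^ r
      ≤ 𝔼 x, (a + b) ^ r *
          (a / (a + b) * (u x ^ r / a ^ r) + b / (a + b) * (v x ^ r / b ^ r)) :=
        expect_le_expect fun x _ => hpt x
    _ = (a + b) ^ r * (a / (a + b) * ((𝔼 x, u x ^ r) / a ^ r)
          + b / (a + b) * ((𝔼 x, v x ^ r) / b ^ r)) := by
        rw [← mul_expect, expect_add_distrib, ← mul_expect, ← mul_expect, expect_div, expect_div]
    _ ≤ (a + b) ^ r * (a / (a + b) * 1 + b / (a + b) * 1) := by
        gcongr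
        · exact div_le_one_of_le₀ hua (by positivity)
        · exact div_le_one_of_le₀ hvb (by positivity)
    _ = (a + b) ^ r := by field_simp

/-- The Bonami inequality for even moments, in terms of Fourier coefficients. -/
lemma bonami {r : ℕ} (hr : r ≠ 0) (A : Finset V) (a : Finset V → ℝ) :
    𝔼 x, (∑ S ∈ A.powerset, a S * chi S x) ^ (2 * r)
      ≤ (∑ S ∈ A.powerset, (2 * r - 1) ^ S.card * a S ^ 2) ^ r := by
  have hC : (0 : ℝ) ≤ 2 * r - 1 := by
    have : (1 : ℝ) ≤ r := by exact_mod_cast Nat.one_le_iff_ne_zero.mpr hr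
    linarith
  induction A using Finset.induction_on generalizing a with
  | empty =>
    simp [chi, pow_mul]
  | insert i A hi ih =>
    -- The function splits as g + x_i h with g and h independent of x_i. Averaging over the sign of
    -- x_i leaves the two-point inequality, then Minkowski combines the inductive bounds for g and
    -- h.
    set g : Cube V → ℝ := fun x => ∑ S ∈ A.powerset, a S * chi S x with hg
    set h : Cube V → ℝ := fun x => ∑ S ∈ A.powerset, a (insert i S) * chi S x with hh
    have hnot : ∀ S ∈ A.powerset, i ∉ S := fun S hS hiS => hi (mem_powerset.mp hS hiS)
    have hgf : ∀ x, g (flip i x) = g x := fun x =>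
      sum_congr rfl fun S hS => by rw [chi_flip_of_notMem (hnot S hS)]
    have hhf : ∀ x, h (flip i x) = h x := fun x =>
      sum_congr rfl fun S hS => by rw [chi_flip_of_notMem (hnot S hS)]
    have split : ∀ x, ∑ S ∈ (insert i A).powerset, a S * chi S x
        = g x + ((x i : ℤ) : ℝ) * h x := fun x => by
      rw [sum_powerset_insert hi, hg, hh]
      simp only [mul_sum]
      congr 1
      exact sum_congr rfl fun S hS => by rw [chi_insert (hnot S hS)]; ring
    have hflip : ∀ x, g (flip i x) + ((flip i x i : ℤ) : ℝ) * h (flip i x)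
        = g x - ((x i : ℤ) : ℝ) * h x := fun x => by
      rw [hgf, hhf]; simp [flip]; ring
    have sym := expect_flip i (fun x => (g x + ((x i : ℤ) : ℝ) * h x) ^ (2 * r))
    simp only [hflip] at sym
    calc 𝔼 x, (∑ S ∈ (insert i A).powerset, a S * chi S x) ^ (2 * r)
        = 𝔼 x, (g x + ((x i : ℤ) : ℝ) * h x) ^ (2 * r) := by simp only [split]
      _ = 𝔼 x, ((g x + ((x i : ℤ) : ℝ) * h x) ^ (2 * r)
            + (g x - ((x i : ℤ) : ℝ) * h x) ^ (2 * r)) / 2 := by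
          rw [← expect_div, expect_add_distrib, sym]; ring
      _ ≤ 𝔼 x, (g x ^ 2 + (2 * r - 1) * h x ^ 2) ^ r := by
          refine expect_le_expect fun x _ => (two_point_inequality r _ _).trans_eq ?_
          rw [mul_pow, sq ((x i : ℤ) : ℝ), unit_cast_mul_self, one_mul]
      _ ≤ (∑ S ∈ A.powerset, (2 * r - 1) ^ S.card * a S ^ 2
            + (2 * r - 1) * ∑ S ∈ A.powerset, (2 * r - 1) ^ S.card * a (insert i S) ^ 2) ^ r := by
          refine expect_add_pow_le hr (fun x => sq_nonneg _) (fun x => by positivity)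
            (sum_nonneg fun S _ => by positivity)
            (mul_nonneg hC (sum_nonneg fun S _ => by positivity)) ?_ ?_
          · simp only [← pow_mul]; exact ih a
          · simp only [mul_pow _ _ r, ← pow_mul, ← mul_expect]
            have := ih fun S => a (insert i S)
            gcongr
      _ = _ := by
          rw [sum_powerset_insert hi, mul_sum]
          congr 2
          refine sum_congr rfl fun S hS => ?_
          rw [card_insert_of_notMem (hnot S hS)]; ring

lemma LowDegree.expect_pow_le {d r : ℕ} {f : Cube V → ℝ} (hf : LowDegree d f) (hr : r ≠ 0) :
    𝔼 x, f x ^ (2 * r) ≤ ((2 * r - 1) ^ d * 𝔼 x, f x ^ 2) ^ r := by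
  have hC : (1 : ℝ) ≤ 2 * r - 1 := by
    have : (1 : ℝ) ≤ r := by exact_mod_cast Nat.one_le_iff_ne_zero.mpr hr
    linarith
  have h := bonami hr univ (fourierCoeff f)
  simp only [powerset_univ, ← fourier_inversion] at h
  refine h.trans (pow_le_pow_left₀ (sum_nonneg fun S _ => by positivity) ?_ r)
  rw [← parseval, mul_sum]
  refine sum_le_sum fun S _ => ?_
  by_cases hS : d < S.card
  · simp [hf S hS]
  · gcongr
    exact not_lt.mp hS

lemma LowDegree.expect_pow_four_le {d : ℕ} {f : Cube V → ℝ} (hf : LowDegree d f) :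
    𝔼 x, f x ^ 4 ≤ 9 ^ d * (𝔼 x, f x ^ 2) ^ 2 := by
  have h := hf.expect_pow_le two_ne_zero
  norm_num [mul_pow, ← pow_mul, mul_comm d] at h
  rw [pow_mul] at h
  norm_num at h
  exact h

/-! ### Polynomials as functions on the cube -/

lemma unit_cast_pow (u : ℤˣ) (m : ℕ) :
    ((u : ℤ) : ℝ) ^ m = if Odd m then ((u : ℤ) : ℝ) else 1 := by
  split_ifs with h
  · obtain ⟨l, rfl⟩ := h
    rw [pow_succ, pow_mul, sq, unit_cast_mul_self, one_pow, one_mul]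
  · obtain ⟨l, rfl⟩ := Nat.not_odd_iff_even.mp h
    rw [← two_mul, pow_mul, sq, unit_cast_mul_self, one_pow]

/-- Since x_i² = 1, only the parities of the exponents survive, so `q` need not be multilinear. -/
lemma evalCube_eq_sum_chi (q : MvPolynomial V ℝ) (x : Cube V) :
    evalCube q x = ∑ m ∈ q.support, q.coeff m * chi {i | Odd (m i)} x := by
  rw [evalCube, MvPolynomial.eval_eq']
  refine sum_congr rfl fun m _ => ?_
  simp only [unit_cast_pow, chi, prod_filter]

lemma card_odd_le {q : MvPolynomial V ℝ} {m : V →₀ ℕ} (hm : m ∈ q.support) :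
    (({i | Odd (m i)} : Finset V)).card ≤ q.totalDegree := by
  refine le_trans ?_ (MvPolynomial.le_totalDegree hm)
  rw [Finsupp.sum_fintype _ _ (fun _ => rfl), card_filter]
  refine sum_le_sum fun i _ => ?_
  split_ifs with h
  · exact h.pos
  · exact Nat.zero_le _

lemma expect_chi_mul_chi {S T : Finset V} (h : S ≠ T) : 𝔼 x, chi S x * chi T x = 0 := by
  have : ∃ i, ¬(i ∈ S ↔ i ∈ T) := by
    by_contra! hc
    exact h (Finset.ext hc)
  obtain ⟨i, hi⟩ := this
  have e := expect_flip i (fun x => chi S x * chi T x)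
  have e2 : ∀ x, chi S (flip i x) * chi T (flip i x) = -(chi S x * chi T x) := by
    intro x
    by_cases hS : i ∈ S
    · rw [chi_flip_of_mem hS, chi_flip_of_notMem (by tauto)]; ring
    · rw [chi_flip_of_notMem hS, chi_flip_of_mem (by tauto)]; ring
  simp only [e2, expect_neg_distrib] at e
  linarith

lemma lowDegree_evalCube {d : ℕ} {q : MvPolynomial V ℝ} (hq : q.totalDegree ≤ d) :
    LowDegree d (evalCube q) := fun S hS => by
  simp only [fourierCoeff, evalCube_eq_sum_chi, sum_mul]
  rw [expect_sum_comm]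
  refine sum_eq_zero fun m hm => ?_
  simp only [mul_assoc]
  rw [← mul_expect, expect_chi_mul_chi, mul_zero]
  rintro rfl
  exact absurd ((card_odd_le hm).trans hq) (not_le.mpr hS)

lemma walshCoeff_eq (p : MvPolynomial V ℝ) (S : Finset V) :
    walshCoeff p S = fourierCoeff (evalCube p) S := by
  rw [fourierCoeff, expect_cube]; rfl

lemma influence_eq (p : MvPolynomial V ℝ) (i : V) : influence p i = inf (evalCube p) i := by
  simp only [influence, walshCoeff_eq, inf_eq_sum]

/-! ### `k`-wise independent distributions -/

/-- The expectation of `f` under a distribution on the cube. -/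
def expectUnder (D : PMF (Cube V)) (f : Cube V → ℝ) : ℝ := ∑ x, (D x).toReal * f x

lemma prob_eq (D : PMF (Cube V)) (E : Set (Cube V)) :
    prob D E = expectUnder D (E.indicator 1) := by
  classical
  rw [prob, PMF.toOuterMeasure_apply_fintype, ENNReal.toReal_sum, expectUnder]
  · refine sum_congr rfl fun x _ => ?_
    by_cases h : x ∈ E <;> simp [h]
  · intro x _
    by_cases h : x ∈ E <;> simp [h, D.apply_ne_top]

lemma expectUnder_mono (D : PMF (Cube V)) {f g : Cube V → ℝ} (h : ∀ x, f x ≤ g x) :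
    expectUnder D f ≤ expectUnder D g :=
  sum_le_sum fun x _ => mul_le_mul_of_nonneg_left (h x) ENNReal.toReal_nonneg

lemma expectUnder_one (D : PMF (Cube V)) : expectUnder D 1 = 1 := by
  simp only [expectUnder, Pi.one_apply, mul_one]
  rw [← ENNReal.toReal_sum fun x _ => D.apply_ne_top x, ← tsum_fintype (L := .unconditional _),
    D.tsum_coe, ENNReal.toReal_one]

lemma expectUnder_sum {ι : Type*} (D : PMF (Cube V)) (s : Finset ι) (f : ι → Cube V → ℝ) :
    expectUnder D (fun x => ∑ i ∈ s, f i x) = ∑ i ∈ s, expectUnder D (f i) := by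
  simp only [expectUnder, mul_sum]
  exact sum_comm

lemma expectUnder_const_mul (D : PMF (Cube V)) (c : ℝ) (f : Cube V → ℝ) :
    expectUnder D (fun x => c * f x) = c * expectUnder D f := by
  simp only [expectUnder, mul_sum]
  exact sum_congr rfl fun x _ => by ring

/-- The characters of subsets of S add up to ∏ (1 + x_i), which is 2^|S| times the indicator that x
is 1 on S. -/
lemma IsKWiseIndependent.sum_powerset {k : ℕ} {D : PMF (Cube V)} (hD : IsKWiseIndependent k D)
    {S : Finset V} (hS : S.card ≤ k) : ∑ T ∈ S.powerset, expectUnder D (chi T) = 1 := by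
  have h := hD S hS 1
  rw [prob_eq] at h
  rw [← expectUnder_sum]
  have e : (fun x => ∑ T ∈ S.powerset, chi T x)
      = fun x => 2 ^ S.card * ({x : Cube V | ∀ i ∈ S, x i = (1 : Cube V) i} : Set _).indicator 1 x := by
    funext x
    have h1 : ∑ T ∈ S.powerset, chi T x = ∏ i ∈ S, (1 + ((x i : ℤ) : ℝ)) := by
      rw [prod_one_add]; rfl
    rw [h1]
    by_cases hx : ∀ i ∈ S, x i = (1 : Cube V) i
    · rw [Set.indicator_of_mem (by exact hx), prod_congr rfl fun i hi => by rw [hx i hi]]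
      norm_num
    · rw [Set.indicator_of_notMem (by exact hx), mul_zero]
      push Not at hx
      obtain ⟨i, hi, hxi⟩ := hx
      refine prod_eq_zero hi ?_
      rw [(Int.units_eq_one_or (x i)).resolve_left hxi]; simp
  rw [e, expectUnder_const_mul, h, ← mul_pow]
  norm_num

/-- By induction on S, the empty set already contributes 1 to the sum over subsets and the other
proper subsets contribute 0, so nothing is left for S. -/
lemma IsKWiseIndependent.expectUnder_chi {k : ℕ} {D : PMF (Cube V)}
    (hD : IsKWiseIndependent k D) {S : Finset V} (hS : S.card ≤ k) :
    expectUnder D (chi S) = if S = ∅ then 1 else 0 := by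
  induction S using Finset.strongInduction with
  | H S ih =>
    have h0 : expectUnder D (chi ∅) = 1 := by
      rw [show (chi ∅ : Cube V → ℝ) = 1 from funext fun x => by simp [chi], expectUnder_one]
    split_ifs with hne
    · rw [hne, h0]
    have h := hD.sum_powerset hS
    rw [← add_sum_erase _ _ (mem_powerset_self S)] at h
    have h2 : ∑ T ∈ S.powerset.erase S, expectUnder D (chi T)
        = ∑ T ∈ S.powerset.erase S, if T = ∅ then 1 else 0 := by
      refine sum_congr rfl fun T hT => ?_
      rw [mem_erase, mem_powerset] at hT
      exact ih T (hT.2.ssubset_of_ne hT.1) ((card_le_card hT.2).trans hS)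
    rw [h2, sum_ite_eq', if_pos (by simp [Ne.symm hne])] at h
    linarith

lemma IsKWiseIndependent.expectUnder_evalCube {k : ℕ} {D : PMF (Cube V)}
    (hD : IsKWiseIndependent k D) {q : MvPolynomial V ℝ} (hq : q.totalDegree ≤ k) :
    expectUnder D (evalCube q) = 𝔼 x, evalCube q x := by
  rw [show evalCube q = _ from funext (evalCube_eq_sum_chi q), expectUnder_sum, expect_sum_comm]
  refine sum_congr rfl fun m hm => ?_
  rw [expectUnder_const_mul, ← mul_expect, hD.expectUnder_chi ((card_odd_le hm).trans hq),
    expect_chi]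

lemma LowDegree.sub_const {d : ℕ} {f : Cube V → ℝ} (hf : LowDegree d f) (c : ℝ) :
    LowDegree d fun x => f x - c := fun S hS => by
  have h := hf S hS
  simp only [fourierCoeff] at h
  have hne : S ≠ ∅ := by rintro rfl; simp at hS
  simp only [fourierCoeff, sub_mul, expect_sub_distrib, h, ← mul_expect, expect_chi, hne,
    if_false, mul_zero, sub_zero]

lemma expect_sub_sq (f : Cube V → ℝ) :
    𝔼 x, (f x - 𝔼 y, f y) ^ 2 = 𝔼 x, f x ^ 2 - (𝔼 x, f x) ^ 2 := by
  have : ∀ x, (f x - 𝔼 y, f y) ^ 2 = f x ^ 2 - 2 * (𝔼 y, f y) * f x + (𝔼 y, f y) ^ 2 :=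
    fun x => by ring
  simp only [this]
  rw [expect_add_distrib, expect_sub_distrib, ← mul_expect, expect_const univ_nonempty]
  ring

lemma abs_le_abs_sub_of_sgn_ne {s t : ℝ} (h : sgn s ≠ sgn t) : |t| ≤ |s - t| := by
  unfold sgn at h
  split_ifs at h with h1 h2 h2
  · exact absurd rfl h
  · rw [abs_of_nonneg (not_lt.mp h2), abs_of_nonpos (by linarith)]; linarith
  · rw [abs_of_neg h2, abs_of_nonneg (by linarith)]; linarith
  · exact absurd rfl h

/-- A low-degree polynomial whose mean dominates its standard deviation has nearly constant sign
under every `k`-wise independent distribution. -/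
lemma isCloseToConst_of_variance_le {d r k : ℕ} {τ : ℝ} {q : MvPolynomial V ℝ}
    (hq : q.totalDegree ≤ d) (hr : r ≠ 0) (hk : 2 * r * d ≤ k) (hτ : (1 / 2 : ℝ) ^ r ≤ τ)
    (hμ : 𝔼 x, evalCube q x ≠ 0)
    (hvar : 2 * ((2 * r - 1) ^ d * (𝔼 x, evalCube q x ^ 2 - (𝔼 x, evalCube q x) ^ 2))
      ≤ (𝔼 x, evalCube q x) ^ 2) :
    IsCloseToConstUnderKWise k τ (ptf q) := by
  intro D hD
  set μ := 𝔼 x, evalCube q x with hμ'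
  refine ⟨sgn μ, ?_⟩
  have hpos : 0 < μ ^ (2 * r) := by rw [pow_mul]; positivity
  have hev : ∀ x, evalCube ((q - MvPolynomial.C μ) ^ (2 * r)) x
      = (evalCube q x - μ) ^ (2 * r) := fun x => by simp [evalCube]
  have hdeg : ((q - MvPolynomial.C μ) ^ (2 * r)).totalDegree ≤ k := by
    refine (MvPolynomial.totalDegree_pow _ _).trans (le_trans ?_ hk)
    gcongr
    exact (MvPolynomial.totalDegree_sub_C_le _ _).trans hq
  have hmoment := ((lowDegree_evalCube hq).sub_const μ).expect_pow_le hr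
  rw [expect_sub_sq] at hmoment
  have hr1 : (1 : ℝ) ≤ r := by exact_mod_cast Nat.one_le_iff_ne_zero.mpr hr
  have hW : 0 ≤ 𝔼 x, evalCube q x ^ 2 - μ ^ 2 := by
    rw [hμ', ← expect_sub_sq]; exact expect_nonneg fun _ _ => sq_nonneg _
  -- A wrong sign forces |q - μ| ≥ |μ|, so Markov's inequality applies to the 2r-th moment. That
  -- moment is the same under `D` as under the uniform measure, where hypercontractivity bounds it.
  calc prob D {x | ptf q x ≠ sgn μ}
      ≤ expectUnder D fun x => (μ ^ (2 * r))⁻¹ * evalCube ((q - MvPolynomial.C μ) ^ (2 * r)) x := by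
        rw [prob_eq]
        refine expectUnder_mono D fun x => ?_
        rw [hev]
        by_cases hx : ptf q x ≠ sgn μ
        · rw [Set.indicator_of_mem (by exact hx), Pi.one_apply, inv_mul_eq_div, one_le_div hpos,
            pow_mul, pow_mul]
          exact pow_le_pow_left₀ (sq_nonneg _) (sq_le_sq.mpr (abs_le_abs_sub_of_sgn_ne hx)) r
        · rw [Set.indicator_of_notMem (by exact hx), pow_mul (_ - _)]
          positivity
    _ = (μ ^ (2 * r))⁻¹ * 𝔼 x, (evalCube q x - μ) ^ (2 * r) := by
        rw [expectUnder_const_mul, hD.expectUnder_evalCube hdeg]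
        simp only [hev]
    _ ≤ (μ ^ (2 * r))⁻¹ * (μ ^ 2 / 2) ^ r := by
        gcongr
        refine hmoment.trans (pow_le_pow_left₀ (mul_nonneg (pow_nonneg (by linarith) _) hW) ?_ r)
        linarith
    _ = (1 / 2) ^ r := by
        rw [div_pow, pow_mul, one_div, inv_pow]
        rw [pow_mul] at hpos
        field_simp
    _ ≤ τ := hτ

/-- Every Boolean function is `1/2`-close to a constant. -/
lemma isCloseToConst_of_half_le {k : ℕ} {τ : ℝ} (hτ : 1 / 2 ≤ τ) (f : Cube V → ℤˣ) :
    IsCloseToConstUnderKWise k τ f := by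
  intro D _
  by_contra! h
  have h1 := h 1
  have h2 := h (-1)
  have : prob D {x | f x ≠ 1} + prob D {x | f x ≠ -1} = 1 := by
    rw [prob_eq, prob_eq, ← expectUnder_one D]
    simp only [expectUnder, ← sum_add_distrib, ← mul_add]
    refine sum_congr rfl fun x _ => ?_
    rcases Int.units_eq_one_or (f x) with hx | hx <;> simp [hx]
  linarith

/-! ### Restrictions -/

/-- The restriction of `f` in which coordinates outside `R` are fixed as in `z`. -/
def fixOff (f : Cube V → ℝ) (R : Finset V) (z : Cube V) (y : Cube V) : ℝ := f (R.piecewise y z)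

/-- Exchanging the R-coordinates of two independent uniform points is a measure-preserving
involution. -/
lemma expect_piecewise (R : Finset V) (g : Cube V → ℝ) :
    𝔼 x, 𝔼 y, g (R.piecewise y x) = 𝔼 x, g x := by
  have inv : Function.Involutive fun a : Cube V × Cube V =>
      (R.piecewise a.2 a.1, R.piecewise a.1 a.2) := by
    rintro ⟨x, y⟩
    ext j <;> by_cases hj : j ∈ R <;> simp [hj]
  have h := Fintype.expect_equiv (Function.Involutive.toPerm _ inv)
    (fun a : Cube V × Cube V => g (R.piecewise a.2 a.1)) (fun a => g a.1) (fun _ => rfl)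
  rw [← univ_product_univ, expect_product, expect_product] at h
  simpa using h

lemma expect_comp_subtype (R : Finset V) (g : Cube {j // j ∈ R} → ℝ) :
    𝔼 x : Cube V, g (fun j => x j) = 𝔼 y, g y := by
  have h := Fintype.expect_equiv (Equiv.piEquivPiSubtypeProd (fun j => j ∈ R) fun _ : V => ℤˣ)
    (fun x => g (fun j => x j)) (fun a => g a.1) (fun _ => rfl)
  rw [h, ← univ_product_univ, expect_product]
  simp

lemma lap_fixOff_of_mem {R : Finset V} {i : V} (hi : i ∈ R) (f : Cube V → ℝ) (z y : Cube V) :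
    lap i (fixOff f R z) y = lap i f (R.piecewise y z) := by
  have : R.piecewise (flip i y) z = flip i (R.piecewise y z) := by
    ext j
    by_cases hj : j = i
    · subst hj; simp [hi, flip]
    · by_cases hR : j ∈ R <;> simp [hR, flip, hj]
  simp only [lap, fixOff, this]

lemma lap_fixOff_of_notMem {R : Finset V} {i : V} (hi : i ∉ R) (f : Cube V → ℝ) (z y : Cube V) :
    lap i (fixOff f R z) y = 0 := by
  have : R.piecewise (flip i y) z = R.piecewise y z := by
    ext j
    by_cases hR : j ∈ R
    · simp [hR, flip, ne_of_mem_of_not_mem hR hi]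
    · simp [hR]
  simp only [lap, fixOff, this, sub_self, zero_div]

lemma inf_fixOff_of_notMem {R : Finset V} {i : V} (hi : i ∉ R) (f : Cube V → ℝ) (z : Cube V) :
    inf (fixOff f R z) i = 0 := by
  simp [inf, lap_fixOff_of_notMem hi]

lemma expect_inf_fixOff {R : Finset V} {i : V} (hi : i ∈ R) (f : Cube V → ℝ) :
    𝔼 z, inf (fixOff f R z) i = inf f i := by
  simp only [inf, lap_fixOff_of_mem hi]
  exact expect_piecewise R fun x => lap i f x ^ 2

section Restrict

variable {n : ℕ}

lemma evalCube_restrict (p : MvPolynomial (Fin n) ℝ) (R : Finset (Fin n)) (z y : Cube (Fin n)) :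
    evalCube (restrict p R z) (fun j => y j) = fixOff (evalCube p) R z y := by
  simp only [evalCube, restrict, fixOff]
  rw [← MvPolynomial.aeval_eq_eval, MvPolynomial.aeval_bind₁, ← MvPolynomial.aeval_eq_eval]
  congr 2
  funext j
  by_cases h : j ∈ R <;> simp [h]

lemma totalDegree_restrict_le (p : MvPolynomial (Fin n) ℝ) (R : Finset (Fin n))
    (z : Cube (Fin n)) : (restrict p R z).totalDegree ≤ p.totalDegree := by
  rw [restrict, MvPolynomial.bind₁, MvPolynomial.aeval_def, MvPolynomial.eval₂_eq]
  refine MvPolynomial.totalDegree_finsetSum_le fun m hm => ?_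
  refine (MvPolynomial.totalDegree_mul _ _).trans ?_
  rw [MvPolynomial.algebraMap_eq, MvPolynomial.totalDegree_C, zero_add]
  refine (MvPolynomial.totalDegree_finsetProd _ _).trans
    (le_trans (sum_le_sum fun i _ => ?_) (MvPolynomial.le_totalDegree hm))
  refine (MvPolynomial.totalDegree_pow _ _).trans ?_
  split_ifs
  · simp
  · rw [MvPolynomial.totalDegree_C]; simp

lemma restrict_congr {p : MvPolynomial (Fin n) ℝ} {R : Finset (Fin n)} {z w : Cube (Fin n)}
    (h : ∀ j ∉ R, z j = w j) : restrict p R z = restrict p R w := by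
  unfold restrict
  congr 2
  funext j
  by_cases hj : j ∈ R
  · simp [hj]
  · simp [hj, h j hj]

/-- `fixOff` stays on the full cube, where it is the restricted polynomial with its variables
renamed back. -/
lemma lowDegree_fixOff {d : ℕ} {p : MvPolynomial (Fin n) ℝ} (hp : p.totalDegree ≤ d)
    (R : Finset (Fin n)) (z : Cube (Fin n)) : LowDegree d (fixOff (evalCube p) R z) := by
  have h : fixOff (evalCube p) R z
      = evalCube (MvPolynomial.rename Subtype.val (restrict p R z)) := by
    funext y
    rw [← evalCube_restrict]
    simp only [evalCube, MvPolynomial.eval_rename]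
    rfl
  rw [h]
  exact lowDegree_evalCube ((MvPolynomial.totalDegree_rename_le _ _).trans
    ((totalDegree_restrict_le p R z).trans hp))

lemma influence_restrict (p : MvPolynomial (Fin n) ℝ) (R : Finset (Fin n)) (z : Cube (Fin n))
    (i : {j // j ∈ R}) : influence (restrict p R z) i = inf (fixOff (evalCube p) R z) i := by
  rw [influence_eq, inf, inf, ← expect_comp_subtype]
  refine expect_congr rfl fun y _ => ?_
  have : (flip i fun j : {j // j ∈ R} => y j) = fun j : {j // j ∈ R} => flip (i : Fin n) y j := by
    funext j
    by_cases h : j = i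
    · subst h; simp [flip]
    · simp [flip, h, Subtype.coe_injective.ne h]
  simp only [lap, this, evalCube_restrict]

lemma isRegular_restrict {τ : ℝ} {p : MvPolynomial (Fin n) ℝ} {R : Finset (Fin n)}
    {z : Cube (Fin n)} (h : ∀ i ∈ R, inf (fixOff (evalCube p) R z) i
      ≤ τ * ∑ j ∈ R, inf (fixOff (evalCube p) R z) j) : IsRegular τ (restrict p R z) := by
  intro i
  rw [totalInfluence]
  simp only [influence_restrict]
  rw [sum_coe_sort R fun j => inf (fixOff (evalCube p) R z) j]
  exact h i i.2

end Restrict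

/-! ### Probability on finite sets -/

section Probability

variable {ι : Type*} [Fintype ι]

open Classical in
/-- The probability of an event under the uniform distribution. -/
def pr (E : ι → Prop) : ℝ := 𝔼 x, if E x then 1 else 0

lemma pr_mono {E F : ι → Prop} (h : ∀ x, E x → F x) : pr E ≤ pr F := by
  refine expect_le_expect fun x _ => ?_
  by_cases hE : E x
  · simp [hE, h x hE]
  · rw [if_neg hE]; split_ifs <;> norm_num

lemma pr_sub_le (E F : ι → Prop) : pr E - pr F ≤ pr fun x => E x ∧ ¬F x := by
  rw [pr, pr, ← expect_sub_distrib]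
  refine expect_le_expect fun x _ => ?_
  by_cases hE : E x <;> by_cases hF : F x <;> simp [hE, hF]

lemma pr_eq_one [Nonempty ι] {E : ι → Prop} (h : ∀ x, E x) : pr E = 1 := by simp [pr, h]

/-- Markov's inequality. -/
lemma pr_le_of_expect_le {E : ι → Prop} {g : ι → ℝ} {c : ℝ} (hc : 0 < c) (hg : ∀ x, 0 ≤ g x)
    (hE : ∀ x, E x → c ≤ g x) : pr E ≤ (𝔼 x, g x) / c := by
  rw [pr, expect_div]
  refine expect_le_expect fun x _ => ?_
  split_ifs with h
  · rw [one_le_div hc]; exact hE x h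
  · exact div_nonneg (hg x) hc.le

/-- The Paley-Zygmund inequality. -/
lemma paley_zygmund [Nonempty ι] {Z : ι → ℝ} {B : ℝ} (hpos : 0 < 𝔼 x, Z x)
    (hB : 0 < B) (h2 : 𝔼 x, Z x ^ 2 ≤ B * (𝔼 x, Z x) ^ 2) :
    1 / (4 * B) ≤ pr fun x => (𝔼 x, Z x) / 2 ≤ Z x := by
  classical
  set T := 𝔼 x, Z x with hT
  -- Below T/2 the first term suffices; above it, AM-GM gives Z ≤ Z²/(4BT) + BT. Averaging yields T
  -- ≤ T/2 + T/4 + BT·Pr.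
  have hpt : ∀ x, Z x ≤ T / 2 + 1 / (4 * B * T) * Z x ^ 2
      + B * T * (if T / 2 ≤ Z x then 1 else 0) := by
    intro x
    split_ifs with h
    · have h3 : 0 ≤ 1 / (4 * B * T) * (Z x - 2 * B * T) ^ 2 := by positivity
      have h4 : 1 / (4 * B * T) * (Z x - 2 * B * T) ^ 2
          = 1 / (4 * B * T) * Z x ^ 2 - Z x + B * T := by field_simp; ring
      linarith
    · have : 0 ≤ 1 / (4 * B * T) * Z x ^ 2 := by positivity
      linarith
  have h := expect_le_expect (s := univ) fun x _ => hpt x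
  rw [expect_add_distrib, expect_add_distrib, expect_const univ_nonempty, ← mul_expect,
    ← mul_expect, ← hT] at h
  have h5 : 1 / (4 * B * T) * 𝔼 x, Z x ^ 2 ≤ T / 4 := by
    calc 1 / (4 * B * T) * 𝔼 x, Z x ^ 2 ≤ 1 / (4 * B * T) * (B * T ^ 2) := by gcongr
      _ = T / 4 := by field_simp
  have h6 : T * (1 / 4) ≤ T * (B * pr fun x => T / 2 ≤ Z x) := by
    have : (pr fun x => T / 2 ≤ Z x) = 𝔼 x, if T / 2 ≤ Z x then (1 : ℝ) else 0 := by
      unfold pr; congr! 1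
    rw [this]; linarith
  have h7 := le_of_mul_le_mul_left h6 hpos
  rw [div_le_iff₀ (by positivity)]
  linarith

/-- Jensen's inequality for powers. -/
lemma expect_pow_le_expect_pow [Nonempty ι] {u : ι → ℝ} (hu : ∀ x, 0 ≤ u x) (r : ℕ) :
    (𝔼 x, u x) ^ r ≤ 𝔼 x, u x ^ r := by
  rw [Fintype.expect_eq_sum_div_card, Fintype.expect_eq_sum_div_card]
  have h := Real.pow_arith_mean_le_arith_mean_pow univ (fun _ : ι => (Fintype.card ι : ℝ)⁻¹) u
    (fun _ _ => by positivity) (by simp) (fun x _ => hu x) r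
  rw [← mul_sum, ← mul_sum] at h
  rwa [inv_mul_eq_div, inv_mul_eq_div] at h

lemma sq_expect_mul_le (u v : ι → ℝ) :
    (𝔼 x, u x * v x) ^ 2 ≤ (𝔼 x, u x ^ 2) * 𝔼 x, v x ^ 2 := by
  simp only [Fintype.expect_eq_sum_div_card, div_pow, div_mul_div_comm, ← sq]
  gcongr
  exact sum_mul_sq_le_sq_mul_sq _ _ _

end Probability

/-! ### Random restrictions -/

variable {V : Type} [Fintype V] [DecidableEq V]

lemma sum_inf_fixOff (f : Cube V → ℝ) (R : Finset V) (z : Cube V) :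
    ∑ i, inf (fixOff f R z) i = ∑ i ∈ R, inf (fixOff f R z) i :=
  (sum_subset (subset_univ R) fun _ _ h => inf_fixOff_of_notMem h f z).symm

lemma expect_sum_inf_fixOff (f : Cube V → ℝ) (R : Finset V) :
    𝔼 z, ∑ i, inf (fixOff f R z) i = ∑ i ∈ R, inf f i := by
  simp only [sum_inf_fixOff]
  rw [expect_sum_comm]
  exact sum_congr rfl fun i hi => expect_inf_fixOff hi f

/-- A restricted influence is a conditional mean of (`lap i f`)², so Jensen passes to the 2r-th
moment of `lap i f`, which has low degree. -/
lemma LowDegree.expect_inf_fixOff_pow_le {d r : ℕ} {f : Cube V → ℝ} (hf : LowDegree d f)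
    (hr : r ≠ 0) {R : Finset V} {i : V} (hi : i ∈ R) :
    𝔼 z, inf (fixOff f R z) i ^ r ≤ ((2 * r - 1) ^ d * inf f i) ^ r := by
  refine le_trans ?_ ((hf.lowDegree_lap i).expect_pow_le hr)
  rw [← expect_piecewise R fun x => lap i f x ^ (2 * r)]
  refine expect_le_expect fun z _ => ?_
  simp only [inf, lap_fixOff_of_mem hi, pow_mul]
  exact expect_pow_le_expect_pow (fun _ => sq_nonneg _) r

/-- The square is expanded, and Cauchy-Schwarz reduces cross terms to the second moments of single
influences. -/
lemma LowDegree.expect_sq_sum_inf_fixOff_le {d : ℕ} {f : Cube V → ℝ} (hf : LowDegree d f)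
    (R : Finset V) :
    𝔼 z, (∑ i, inf (fixOff f R z) i) ^ 2 ≤ 9 ^ d * (∑ i ∈ R, inf f i) ^ 2 := by
  have h2 : ∀ i ∈ R, 𝔼 z, inf (fixOff f R z) i ^ 2 ≤ 9 ^ d * inf f i ^ 2 := fun i hi => by
    have := hf.expect_inf_fixOff_pow_le two_ne_zero hi
    rw [mul_pow, ← pow_mul, mul_comm d, pow_mul] at this
    norm_num at this
    exact this
  simp only [sum_inf_fixOff, sq, sum_mul_sum]
  simp only [expect_sum_comm, mul_sum]
  refine sum_le_sum fun i hi => sum_le_sum fun j hj => ?_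
  refine abs_le_of_sq_le_sq' ((sq_expect_mul_le _ _).trans ?_)
    (mul_nonneg (by positivity) (mul_nonneg (inf_nonneg f i) (inf_nonneg f j))) |>.2
  calc _ ≤ (9 ^ d * inf f i ^ 2) * (9 ^ d * inf f j ^ 2) :=
        mul_le_mul (h2 i hi) (h2 j hj) (expect_nonneg fun _ _ => sq_nonneg _) (by positivity)
    _ = _ := by ring

/-- If every free influence is small relative to the total free influence, then a random
restriction is regular with probability at least `1 / (8 * 9 ^ d)`. -/
lemma LowDegree.pr_regular {d Q : ℕ} {τ τ' : ℝ} {f : Cube V → ℝ} (hf : LowDegree d f)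
    (hτ : 0 < τ) (hτ' : 0 < τ') {R : Finset V}
    (hreg : ∀ i ∈ R, inf f i ≤ τ' * ∑ j ∈ R, inf f j)
    (hnum : (2 * (2 * (Q + 1) - 1) ^ d * τ' / τ) ^ (Q + 1) ≤ τ' / (8 * 9 ^ d)) :
    1 / (8 * 9 ^ d) ≤ pr fun z => ∀ i,
      inf (fixOff f R z) i ≤ τ * ∑ j, inf (fixOff f R z) j := by
  set T := ∑ j ∈ R, inf f j with hT
  have hTm : 𝔼 z, ∑ i, inf (fixOff f R z) i = T := expect_sum_inf_fixOff f R
  have hZ : ∀ z, 0 ≤ ∑ i, inf (fixOff f R z) i := fun z => sum_nonneg fun i _ => inf_nonneg _ i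
  have hT0 : 0 ≤ T := sum_nonneg fun i _ => inf_nonneg _ i
  have h9 : (1 : ℝ) ≤ 9 ^ d := one_le_pow₀ (by norm_num)
  rcases hT0.eq_or_lt with h0 | hTpos
  · rw [pr_eq_one]
    · rw [div_le_one (by positivity)]; linarith
    intro z i
    have h1 : 𝔼 z, ∑ i, inf (fixOff f R z) i = 0 := by rw [hTm, ← h0]
    rw [expect_eq_zero_iff_of_nonneg fun z _ => hZ z] at h1
    have h2 := h1 z (mem_univ z)
    rw [h2, mul_zero]
    exact ((sum_eq_zero_iff_of_nonneg fun i _ => inf_nonneg _ i).mp h2 i (mem_univ i)).le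
  have hPZ := paley_zygmund (by rw [hTm]; exact hTpos) (by positivity : (0 : ℝ) < 9 ^ d)
    (by rw [hTm]; exact hf.expect_sq_sum_inf_fixOff_le R)
  rw [hTm] at hPZ
  have hc : 0 < τ * T / 2 := by positivity
  have hQ : (0 : ℝ) ≤ 2 * (Q + 1) - 1 := by
    have : (0 : ℝ) ≤ Q := Q.cast_nonneg
    linarith
  -- Markov's inequality for the sum of (Q+1)-th powers. Each summand carries inf_i^(Q+1) ≤ (τ'T)^Q
  -- · inf_i, so the sum costs one factor T rather than the number of coordinates.
  have hbad : (pr fun z => ∃ i ∈ R, τ * T / 2 < inf (fixOff f R z) i) ≤ 1 / (8 * 9 ^ d) := by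
    refine (pr_le_of_expect_le (g := fun z => ∑ i ∈ R, inf (fixOff f R z) i ^ (Q + 1))
      (pow_pos hc (Q + 1)) (fun z => sum_nonneg fun i _ => pow_nonneg (inf_nonneg _ i) _) ?_).trans ?_
    · rintro z ⟨i, hi, h⟩
      exact (pow_le_pow_left₀ hc.le h.le _).trans
        (single_le_sum (f := fun i => inf (fixOff f R z) i ^ (Q + 1))
          (fun i _ => pow_nonneg (inf_nonneg _ i) _) hi)
    · rw [expect_sum_comm, div_le_iff₀ (pow_pos hc _)]
      calc ∑ i ∈ R, 𝔼 z, inf (fixOff f R z) i ^ (Q + 1)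
          ≤ ∑ i ∈ R, ((2 * (Q + 1) - 1) ^ d) ^ (Q + 1) * (τ' * T) ^ Q * inf f i := by
            refine sum_le_sum fun i hi => ?_
            have h := hf.expect_inf_fixOff_pow_le (Nat.succ_ne_zero Q) hi
            push_cast at h
            refine h.trans ?_
            rw [mul_pow, pow_succ (inf f i), ← mul_assoc]
            have := inf_nonneg f i
            have := hreg i hi
            gcongr
        _ = (2 * (2 * (Q + 1) - 1) ^ d * τ' / τ) ^ (Q + 1) / τ' * (τ * T / 2) ^ (Q + 1) := by
            rw [← mul_sum, ← hT, div_mul_eq_mul_div, ← mul_pow,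
              show 2 * (2 * (Q + 1) - 1) ^ d * τ' / τ * (τ * T / 2)
                = (2 * (Q + 1) - 1) ^ d * (τ' * T) by field_simp,
              mul_pow ((2 * ((Q : ℝ) + 1) - 1) ^ d), pow_succ (τ' * T)]
            field_simp
        _ ≤ τ' / (8 * 9 ^ d) / τ' * (τ * T / 2) ^ (Q + 1) := by gcongr
        _ = 1 / (8 * 9 ^ d) * (τ * T / 2) ^ (Q + 1) := by
            congr 1; field_simp
  calc 1 / (8 * 9 ^ d) = 1 / (4 * 9 ^ d) - 1 / (8 * 9 ^ d) := by field_simp; norm_num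
    _ ≤ _ := sub_le_sub hPZ hbad
    _ ≤ _ := pr_sub_le _ _
    _ ≤ _ := by
        refine pr_mono fun z hz i => ?_
        by_cases hi : i ∈ R
        · have h1 : inf (fixOff f R z) i ≤ τ * T / 2 := by
            by_contra! h
            exact hz.2 ⟨i, hi, h⟩
          have := mul_le_mul_of_nonneg_left hz.1 hτ.le
          linarith
        · rw [inf_fixOff_of_notMem hi]
          exact mul_nonneg hτ.le (hZ z)

/-- If the total free influence is tiny, then with probability at least `1 / (32 * 9 ^ d)` the mean
of a random restriction dominates its variance. -/
lemma LowDegree.pr_variance_le {d : ℕ} {η : ℝ} {f : Cube V → ℝ} (hf : LowDegree d f)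
    (hη : 0 < η) (hη2 : η ≤ 1 / 2) {R : Finset V} (hA : 0 < 𝔼 x, f x ^ 2)
    (hT : ∑ j ∈ R, inf f j ≤ η * 𝔼 x, f x ^ 2) :
    1 / (32 * 9 ^ d) ≤ pr fun z => 𝔼 y, fixOff f R z y ≠ 0 ∧
      𝔼 y, fixOff f R z y ^ 2 - (𝔼 y, fixOff f R z y) ^ 2
        ≤ 128 * 9 ^ d * η * (𝔼 y, fixOff f R z y) ^ 2 := by
  set A := 𝔼 x, f x ^ 2 with hA'
  set q : Cube V → ℝ := fun z => 𝔼 y, fixOff f R z y with hq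
  set W : Cube V → ℝ := fun z => 𝔼 y, fixOff f R z y ^ 2 - q z ^ 2 with hW
  have hW0 : ∀ z, 0 ≤ W z := fun z => by
    simp only [hW, hq]; rw [← expect_sub_sq]; exact expect_nonneg fun _ _ => sq_nonneg _
  have hWm : 𝔼 z, W z ≤ η * A := by
    refine le_trans ?_ hT
    rw [← expect_sum_inf_fixOff]
    exact expect_le_expect fun z _ => poincare _
  have hAq : 𝔼 z, W z = A - 𝔼 z, q z ^ 2 := by
    simp only [hW]
    rw [expect_sub_distrib, hA', ← expect_piecewise R fun x => f x ^ 2]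
    rfl
  -- By Poincaré the mean variance is at most ηA ≤ A/2, and A is the mean variance plus the mean of
  -- q².
  have hq2 : A / 2 ≤ 𝔼 z, q z ^ 2 := by nlinarith
  have hq4 : 𝔼 z, (q z ^ 2) ^ 2 ≤ 4 * 9 ^ d * (𝔼 z, q z ^ 2) ^ 2 := by
    calc 𝔼 z, (q z ^ 2) ^ 2 ≤ 𝔼 z, 𝔼 y, f (R.piecewise y z) ^ 4 := by
          refine expect_le_expect fun z _ => ?_
          have h1 : q z ^ 2 ≤ 𝔼 y, fixOff f R z y ^ 2 := sub_nonneg.mp (hW0 z)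
          refine (pow_le_pow_left₀ (sq_nonneg _) h1 2).trans ?_
          refine (expect_pow_le_expect_pow (fun _ => sq_nonneg _) 2).trans_eq ?_
          simp only [← pow_mul]; rfl
      _ = 𝔼 x, f x ^ 4 := expect_piecewise R fun x => f x ^ 4
      _ ≤ 9 ^ d * A ^ 2 := hf.expect_pow_four_le
      _ ≤ 9 ^ d * (2 * 𝔼 z, q z ^ 2) ^ 2 := by gcongr; linarith
      _ = _ := by ring
  have hPZ := paley_zygmund (Z := fun z => q z ^ 2) (by linarith)
    (by positivity : (0 : ℝ) < 4 * 9 ^ d) hq4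
  -- The threshold makes Markov lose 1/(32·9^d), half of the 1/(16·9^d) given by Paley-Zygmund. The
  -- later 128 is 32 times the 4 from A ≤ 4q².
  have hM := pr_le_of_expect_le (E := fun z => 32 * 9 ^ d * η * A ≤ W z)
    (by positivity : 0 < 32 * 9 ^ d * η * A) hW0 fun z h => h
  have hM2 : (𝔼 z, W z) / (32 * 9 ^ d * η * A) ≤ 1 / (32 * 9 ^ d) := by
    rw [div_le_iff₀ (by positivity)]
    refine hWm.trans_eq ?_
    field_simp
  calc (1 : ℝ) / (32 * 9 ^ d) = 1 / (4 * (4 * 9 ^ d)) - 1 / (32 * 9 ^ d) := by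
        field_simp; norm_num
    _ ≤ _ := sub_le_sub hPZ (hM.trans hM2)
    _ ≤ _ := pr_sub_le _ _
    _ ≤ _ := by
        refine pr_mono fun z hz => ?_
        have h1 : A / 4 ≤ q z ^ 2 := by linarith [hz.1]
        refine ⟨fun h => ?_, ?_⟩
        · have : q z = 0 := h
          rw [this] at h1; linarith
        · calc W z ≤ 32 * 9 ^ d * η * A := (not_le.mp hz.2).le
            _ ≤ 32 * 9 ^ d * η * (4 * q z ^ 2) := by gcongr; linarith
            _ = _ := by ring

/-- Greedily removing coordinates of large weight either leaves a family without dominant members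
or makes the remaining total weight geometrically small. -/
lemma exists_greedy_head {a : V → ℝ} (ha : ∀ i, 0 ≤ a i) {t : ℝ} (ht : 0 < t) (ht1 : t ≤ 1) (m : ℕ) :
    ∃ H : Finset V, H.card ≤ m ∧ (∀ i ∈ H, a i ≠ 0) ∧
      ((∀ i ∈ Hᶜ, a i ≤ t * ∑ j ∈ Hᶜ, a j) ∨ ∑ j ∈ Hᶜ, a j ≤ (1 - t) ^ m * ∑ j, a j) := by
  induction m with
  | zero => exact ⟨∅, by simp, by simp, Or.inr (by simp)⟩
  | succ m ih =>
    obtain ⟨H, hc, hne, h | h⟩ := ih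
    · exact ⟨H, by omega, hne, Or.inl h⟩
    by_cases hr : ∀ i ∈ Hᶜ, a i ≤ t * ∑ j ∈ Hᶜ, a j
    · exact ⟨H, by omega, hne, Or.inl hr⟩
    push Not at hr
    obtain ⟨i, hi, hlt⟩ := hr
    have h0 : 0 ≤ ∑ j ∈ Hᶜ, a j := sum_nonneg fun j _ => ha j
    refine ⟨insert i H, (card_insert_le _ _).trans (by omega), ?_, Or.inr ?_⟩
    · intro j hj
      rcases mem_insert.mp hj with rfl | hj
      · exact ((mul_nonneg ht.le h0).trans_lt hlt).ne'
      · exact hne j hj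
    · have e : (insert i H)ᶜ = Hᶜ.erase i := by ext; simp
      have := sum_erase_eq_sub (f := a) hi
      rw [e, this, pow_succ]
      have := mul_le_mul_of_nonneg_left h (sub_nonneg.mpr ht1)
      linarith

/-- The leaf condition: regularity, or closeness to a constant under bounded independence. -/
def GoodLeaf {V : Type} [Fintype V] [DecidableEq V] (τ κ : ℝ) (q : MvPolynomial V ℝ) : Prop :=
  IsRegular τ q ∨ ∀ k : ℕ, κ ≤ (k : ℝ) → IsCloseToConstUnderKWise k τ (ptf q)

variable {n : ℕ}

lemma fixOff_fixOff (f : Cube (Fin n) → ℝ) {S H : Finset (Fin n)} (hH : H ⊆ S)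
    (z x : Cube (Fin n)) :
    fixOff (fixOff f S z) Hᶜ x = fixOff f (S \ H) (H.piecewise x z) := by
  funext y
  simp only [fixOff]
  congr 1
  funext j
  by_cases h1 : j ∈ H
  · simp [h1, hH h1]
  · by_cases h2 : j ∈ S <;> simp [h1, h2]

/-- Some small set of free variables has the property that fixing it at random produces a good leaf
with probability at least `1 / (32 * 9 ^ d)`. -/
lemma exists_head {d m Q r : ℕ} {τ τ' κ η : ℝ} {p : MvPolynomial (Fin n) ℝ}
    (hp : p.totalDegree ≤ d) (hτ : 0 < τ) (hτ' : 0 < τ') (hτ1 : τ' ≤ 1)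
    (hQ : (2 * (2 * (Q + 1) - 1) ^ d * τ' / τ) ^ (Q + 1) ≤ τ' / (8 * 9 ^ d))
    (hr : r ≠ 0) (hrτ : (1 / 2 : ℝ) ^ r ≤ τ) (hrκ : 2 * r * d ≤ κ) (hη : 0 < η)
    (hηm : (1 - τ') ^ m * d ≤ η) (hηr : 256 * (2 * r - 1) ^ d * 9 ^ d * η ≤ 1)
    (S : Finset (Fin n)) (z : Cube (Fin n)) :
    ∃ H ⊆ S, H.card ≤ m ∧ 1 / (32 * 9 ^ d) ≤
      pr fun x : Cube (Fin n) => GoodLeaf τ κ (restrict p (S \ H) (H.piecewise x z)) := by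
  set f := fixOff (evalCube p) S z with hf'
  have hf : LowDegree d f := lowDegree_fixOff hp S z
  obtain ⟨H, hcard, hne, hH⟩ := exists_greedy_head (inf_nonneg f) hτ' hτ1 m
  -- Frozen coordinates have zero influence, so the greedy choice never selects them.
  have hHS : H ⊆ S := fun i hi => by
    by_contra h
    exact hne i hi (inf_fixOff_of_notMem h _ z)
  refine ⟨H, hHS, hcard, ?_⟩
  have h9 : (1 : ℝ) ≤ 9 ^ d := one_le_pow₀ (by norm_num)
  have reg : (∀ i ∈ Hᶜ, inf f i ≤ τ' * ∑ j ∈ Hᶜ, inf f j) → 1 / (32 * 9 ^ d) ≤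
      pr fun x : Cube (Fin n) => GoodLeaf τ κ (restrict p (S \ H) (H.piecewise x z)) := by
    intro h
    have h1 := hf.pr_regular hτ hτ' h hQ
    refine le_trans ?_ (h1.trans (pr_mono fun x hx => Or.inl (isRegular_restrict fun i _ => ?_)))
    · gcongr; norm_num
    · rw [← sum_inf_fixOff, ← fixOff_fixOff _ hHS]
      exact hx i
  rcases hH with h | h
  · exact reg h
  -- With no influence left, regularity is trivial. Otherwise positivity of the remaining influence
  -- forces 𝔼 f² > 0, which the variance argument needs.
  rcases (sum_nonneg fun j _ => inf_nonneg f j : 0 ≤ ∑ j ∈ Hᶜ, inf f j).eq_or_lt with h0 | hpos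
  · refine reg fun i hi => ?_
    rw [← h0, mul_zero]
    exact ((sum_eq_zero_iff_of_nonneg fun j _ => inf_nonneg f j).mp h0.symm i hi).le
  have hTA : ∑ j ∈ Hᶜ, inf f j ≤ η * 𝔼 x, f x ^ 2 := by
    have := mul_le_mul_of_nonneg_left (sum_inf_le hf) (pow_nonneg (sub_nonneg.mpr hτ1) m)
    have := mul_le_mul_of_nonneg_right hηm
      (expect_nonneg fun x _ => sq_nonneg (f x) : 0 ≤ 𝔼 x, f x ^ 2)
    linarith
  have hr1 : (1 : ℝ) ≤ 2 * r - 1 := by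
    have : (1 : ℝ) ≤ r := by exact_mod_cast Nat.one_le_iff_ne_zero.mpr hr
    linarith
  have hη2 : η ≤ 1 / 2 := by
    have h1 : (1 : ℝ) ≤ (2 * r - 1) ^ d := one_le_pow₀ hr1
    have h2 : 1 * 1 * η ≤ (2 * r - 1) ^ d * 9 ^ d * η := by gcongr
    linarith
  have hA : 0 < 𝔼 x, f x ^ 2 := pos_of_mul_pos_right (hpos.trans_le hTA) hη.le
  refine (hf.pr_variance_le hη hη2 hA hTA).trans (pr_mono fun x hx => Or.inr fun k hk => ?_)
  rw [fixOff_fixOff _ hHS] at hx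
  have e1 : 𝔼 y, evalCube (restrict p (S \ H) (H.piecewise x z)) y
      = 𝔼 y, fixOff (evalCube p) (S \ H) (H.piecewise x z) y := by
    rw [← expect_comp_subtype]; simp only [evalCube_restrict]
  have e2 : 𝔼 y, evalCube (restrict p (S \ H) (H.piecewise x z)) y ^ 2
      = 𝔼 y, fixOff (evalCube p) (S \ H) (H.piecewise x z) y ^ 2 := by
    rw [← expect_comp_subtype (S \ H) fun y => evalCube _ y ^ 2]; simp only [evalCube_restrict]
  refine isCloseToConst_of_variance_le ((totalDegree_restrict_le p _ _).trans hp) hr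
    (by exact_mod_cast hrκ.trans hk) hrτ (by rw [e1]; exact hx.1) ?_
  rw [e1, e2]
  set μ := 𝔼 y, fixOff (evalCube p) (S \ H) (H.piecewise x z) y
  calc 2 * ((2 * r - 1) ^ d * _)
      ≤ 2 * ((2 * r - 1) ^ d * (128 * 9 ^ d * η * μ ^ 2)) := by
        have := hx.2
        gcongr
    _ = 256 * (2 * r - 1) ^ d * 9 ^ d * η * μ ^ 2 := by ring
    _ ≤ 1 * μ ^ 2 := by gcongr
    _ = μ ^ 2 := one_mul _

/-! ### Assembling decision trees -/

section Trees

variable {n : ℕ}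

/-- There is a correctly labelled decision tree over the free variables `S`, for the restriction of
`p` fixing the other variables as in `z`, of depth at most `D` and reaching a leaf with property `P`
with probability at least `π`. -/
def HasTree (p : MvPolynomial (Fin n) ℝ)
    (P : (R : Finset (Fin n)) → MvPolynomial {j // j ∈ R} ℝ → Prop)
    (S : Finset (Fin n)) (z : Cube (Fin n)) (D : ℕ) (π : ℝ) : Prop :=
  ∃ T : DTree n S, T.depth ≤ D ∧
    (∀ x : Cube (Fin n), (∀ j ∉ S, x j = z j) →
      (T.leafAt x).2 = restrict p (T.leafAt x).1 x) ∧ π ≤ T.walkProb P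

variable {p : MvPolynomial (Fin n) ℝ}
  {P : (R : Finset (Fin n)) → MvPolynomial {j // j ∈ R} ℝ → Prop}

/-- The alternative π ≤ 0 permits stopping at a bad leaf once the rounds are used up. -/
lemma hasTree_leaf {S : Finset (Fin n)} {z : Cube (Fin n)} {D : ℕ} {π : ℝ} (hπ : π ≤ 1)
    (h : P S (restrict p S z) ∨ π ≤ 0) : HasTree p P S z D π := by
  refine ⟨.leaf (restrict p S z), Nat.zero_le _,
    fun x hx => restrict_congr fun j hj => (hx j hj).symm, ?_⟩
  rw [DTree.walkProb]
  split_ifs with hP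
  · exact hπ
  · exact h.resolve_left hP

lemma HasTree.node {S : Finset (Fin n)} {z : Cube (Fin n)} {D : ℕ} {π₁ π₂ : ℝ} {i : Fin n}
    (hi : i ∈ S) (h₁ : HasTree p P (S.erase i) (Function.update z i (-1)) D π₁)
    (h₂ : HasTree p P (S.erase i) (Function.update z i 1) D π₂) :
    HasTree p P S z (D + 1) ((π₁ + π₂) / 2) := by
  obtain ⟨T₁, hD₁, hl₁, hπ₁⟩ := h₁
  obtain ⟨T₂, hD₂, hl₂, hπ₂⟩ := h₂
  refine ⟨.node i hi T₁ T₂, ?_, fun x hx => ?_, ?_⟩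
  · simp only [DTree.depth]; omega
  · have key : ∀ b, x i = b → ∀ j ∉ S.erase i, x j = Function.update z i b j := by
      intro b hb j hj
      by_cases hji : j = i
      · subst hji; simpa using hb
      · rw [Function.update_of_ne hji]
        exact hx j fun h => hj (mem_erase.mpr ⟨hji, h⟩)
    by_cases hxi : x i = -1
    · have e : (DTree.node i hi T₁ T₂).leafAt x = T₁.leafAt x := by simp [DTree.leafAt, hxi]
      rw [e]
      exact hl₁ x (key _ hxi)
    · have hx1 : x i = 1 := (Int.units_eq_one_or _).resolve_right hxi
      have e : (DTree.node i hi T₁ T₂).leafAt x = T₂.leafAt x := by simp [DTree.leafAt, hxi]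
      rw [e]
      exact hl₂ x (key _ hx1)
  · rw [DTree.walkProb]; linarith

lemma expect_update (i : Fin n) (π : Cube (Fin n) → ℝ) :
    (𝔼 x, π (Function.update x i (-1)) + 𝔼 x, π (Function.update x i 1)) / 2 = 𝔼 x, π x := by
  have h : ∀ x : Cube (Fin n), π (Function.update x i (-1)) + π (Function.update x i 1)
      = π x + π (flip i x) := by
    intro x
    rcases Int.units_eq_one_or (x i) with hx | hx
    · have : Function.update x i 1 = x := by rw [← hx]; exact Function.update_eq_self i x
      rw [this, flip, hx, add_comm]
    · have : Function.update x i (-1) = x := by rw [← hx]; exact Function.update_eq_self i x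
      rw [this, flip, hx, neg_neg]
  rw [← expect_add_distrib]
  simp only [h]
  rw [expect_add_distrib, expect_flip]
  ring

/-- Query all variables of `H`, then continue with a tree for each outcome. -/
lemma hasTree_query {H S : Finset (Fin n)} (hH : H ⊆ S) {z : Cube (Fin n)} {D : ℕ}
    {π : Cube (Fin n) → ℝ} (h : ∀ x, HasTree p P (S \ H) (H.piecewise x z) D (π x)) :
    HasTree p P S z (D + H.card) (𝔼 x, π x) := by
  induction H using Finset.induction_on generalizing S z π with
  | empty =>
    -- With no query left, all x describe the same restriction, so a point where π reaches its mean
    -- may be chosen.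
    obtain ⟨x, -, hx⟩ := exists_le_of_le_expect univ_nonempty (le_refl (𝔼 x, π x))
    obtain ⟨T, hD, hl, hπ⟩ : HasTree p P S z D (π x) := by simpa using h x
    exact ⟨T, hD, hl, hx.trans hπ⟩
  | insert i H hi ih =>
    rw [card_insert_of_notMem hi, ← add_assoc, ← expect_update i]
    have hiS : i ∈ S := hH (mem_insert_self i H)
    have branch : ∀ b, HasTree p P (S.erase i) (Function.update z i b) (D + H.card)
        (𝔼 x, π (Function.update x i b)) := by
      intro b
      refine ih (fun j hj => mem_erase.mpr
        ⟨ne_of_mem_of_not_mem hj hi, hH (mem_insert_of_mem hj)⟩) fun x => ?_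
      have h1 := h (Function.update x i b)
      have e1 : (insert i H).piecewise (Function.update x i b) z
          = H.piecewise x (Function.update z i b) := by
        funext j
        by_cases hji : j = i
        · subst hji; simp [hi]
        · by_cases hjH : j ∈ H <;> simp [hji, hjH]
      have e2 : S \ insert i H = S.erase i \ H := by
        ext j; simp only [mem_sdiff, mem_insert, mem_erase]; tauto
      rwa [e1, e2] at h1
    exact (branch (-1)).node hiS (branch 1)

/-- Iterating a random restriction that succeeds with probability `δ` fails `N` times in a row only
with probability `(1 - δ) ^ N`. -/
lemma hasTree_iterate {m : ℕ} {δ : ℝ} (hδ1 : δ ≤ 1)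
    (hround : ∀ (S : Finset (Fin n)) (z : Cube (Fin n)), ∃ H ⊆ S, H.card ≤ m ∧
      δ ≤ pr fun x : Cube (Fin n) => P (S \ H) (restrict p (S \ H) (H.piecewise x z)))
    (N : ℕ) (S : Finset (Fin n)) (z : Cube (Fin n)) :
    HasTree p P S z (N * m) (1 - (1 - δ) ^ N) := by
  classical
  induction N generalizing S z with
  | zero => exact hasTree_leaf (by simp) (Or.inr (by simp))
  | succ N ih =>
    obtain ⟨H, hH, hcard, hpr⟩ := hround S z
    have hN : 0 ≤ (1 - δ) ^ N := pow_nonneg (by linarith) N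
    -- The guarantee is 1 at a good outcome and the inductive 1 - (1-δ)^N elsewhere, written
    -- affinely in the indicator so that its mean is computed from `pr`.
    obtain ⟨T, hD, hl, hπ⟩ := hasTree_query (p := p) (P := P) (z := z) (D := N * m)
      (π := fun x => (1 - (1 - δ) ^ N) + (1 - δ) ^ N *
        (if P (S \ H) (restrict p (S \ H) (H.piecewise x z)) then 1 else 0)) hH fun x => by
      split_ifs with hP
      · exact hasTree_leaf (by linarith) (Or.inl hP)
      · simpa using ih (S \ H) (H.piecewise x z)
    refine ⟨T, hD.trans ?_, hl, le_trans ?_ hπ⟩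
    · rw [Nat.succ_mul]; omega
    · rw [expect_add_distrib, expect_const univ_nonempty, ← mul_expect]
      have : (pr fun x : Cube (Fin n) => P (S \ H) (restrict p (S \ H) (H.piecewise x z)))
          = 𝔼 x : Cube (Fin n),
            if P (S \ H) (restrict p (S \ H) (H.piecewise x z)) then (1 : ℝ) else 0 := by
        unfold pr; congr! 1
      rw [← this, pow_succ]
      have := mul_le_mul_of_nonneg_left hpr hN
      linarith

lemma HasTree.exists_tree {d D : ℕ} {π : ℝ} {z : Cube (Fin n)} (hp : p.totalDegree ≤ d)
    (h : HasTree p P univ z D π) :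
    ∃ T : DTree n univ, T.depth ≤ D ∧ (∀ x, T.eval x = ptf p x) ∧
      (∀ x, (T.leafAt x).2.totalDegree ≤ d ∧
        (T.leafAt x).2 = restrict p (T.leafAt x).1 x) ∧ π ≤ T.walkProb P := by
  obtain ⟨T, hD, hl, hπ⟩ := h
  have hl' : ∀ x, (T.leafAt x).2 = restrict p (T.leafAt x).1 x := fun x => hl x (by simp)
  refine ⟨T, hD, fun x => ?_, fun x => ⟨?_, hl' x⟩, hπ⟩
  · rw [DTree.eval, hl', ptf, ptf, evalCube_restrict]
    simp [fixOff, piecewise_same]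
  · rw [hl']
    exact (totalDegree_restrict_le p _ _).trans hp

end Trees

/-! ### Choice of parameters -/

lemma one_sub_pow_le_exp {t : ℝ} (ht : t ≤ 1) (m : ℕ) : (1 - t) ^ m ≤ Real.exp (-(t * m)) := by
  rw [show -(t * m) = m * (-t) by ring, Real.exp_nat_mul]
  exact pow_le_pow_left₀ (by linarith) (Real.one_sub_le_exp_neg t) m

set_option maxHeartbeats 800000 in
-- With L = log₂(1/τ) and M = max(2, dL), every quantity except 1/τ is bounded by a power M^(O(d));
-- numerical constants are absorbed using M ≥ 2.
lemma exists_parameters {d : ℕ} {τ : ℝ} (hd : 1 ≤ d) (hτ : 0 < τ) (hτ2 : τ < 1 / 2) :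
    ∃ (m Q r N : ℕ) (τ' η : ℝ), 0 < τ' ∧ τ' ≤ 1 ∧
      (2 * (2 * ((Q : ℝ) + 1) - 1) ^ d * τ' / τ) ^ (Q + 1) ≤ τ' / (8 * 9 ^ d) ∧
      r ≠ 0 ∧ (1 / 2 : ℝ) ^ r ≤ τ ∧ 2 * (r : ℝ) * d ≤ 4 * (d * Real.logb 2 (1 / τ)) ∧ 0 < η ∧
      (1 - τ') ^ m * d ≤ η ∧ 256 * (2 * (r : ℝ) - 1) ^ d * 9 ^ d * η ≤ 1 ∧
      (1 - 1 / (32 * 9 ^ d) : ℝ) ^ N ≤ τ ∧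
      (N * m : ℝ) ≤ 1 / τ * (max 2 (d * Real.logb 2 (1 / τ))) ^ (35 * d) := by
  set L := Real.logb 2 (1 / τ) with hL
  set M := max 2 (d * L) with hM
  have hd1 : (1 : ℝ) ≤ d := by exact_mod_cast hd
  have hL1 : 1 < L := by
    rw [hL, Real.lt_logb_iff_rpow_lt (by norm_num) (by positivity), Real.rpow_one,
      lt_div_iff₀ hτ]
    linarith
  have hM2 : 2 ≤ M := le_max_left _ _
  have hdL : d * L ≤ M := le_max_right _ _
  have hLM : L ≤ M := by nlinarith
  have hdM : (d : ℝ) ≤ M := by nlinarith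
  have hτL : τ = (2 : ℝ) ^ (-L) := by
    rw [Real.rpow_neg (by norm_num), hL, Real.rpow_logb (by norm_num) (by norm_num)
      (by positivity), one_div, inv_inv]
  set r := ⌈L⌉₊ with hr
  have hLr : L ≤ r := Nat.le_ceil L
  have hrL : (r : ℝ) < L + 1 := Nat.ceil_lt_add_one (by linarith)
  have hr1 : (1 : ℝ) ≤ r := by linarith
  have hr0 : r ≠ 0 := by rintro h; rw [h] at hr1; norm_num at hr1
  have hrτ : (1 / 2 : ℝ) ^ r ≤ τ := by
    rw [hτL, ← Real.rpow_natCast, one_div, Real.inv_rpow (by norm_num),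
      ← Real.rpow_neg (by norm_num)]
    exact Real.rpow_le_rpow_of_exponent_le (by norm_num) (by linarith)
  have hMp : ∀ {a b : ℕ}, a ≤ b → M ^ a ≤ M ^ b := fun h => pow_le_pow_right₀ (by linarith) h
  have two : ∀ a : ℕ, (2 : ℝ) ^ a ≤ M ^ a := fun a => pow_le_pow_left₀ (by norm_num) hM2 a
  have h9M : (9 : ℝ) ^ d ≤ M ^ (4 * d) := by
    rw [pow_mul]
    exact pow_le_pow_left₀ (by norm_num) (by linarith [two 4]) d
  have h9 : (1 : ℝ) ≤ 9 ^ d := one_le_pow₀ (by norm_num)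
  -- The hypercontractive factor at moment order Q + 1 = r + 2. The values of s and t below make the
  -- base of the moment bound 1/s and its target τ/s²; the r further factors 1/s pay for τ.
  set a : ℝ := (2 * r + 3) ^ d with ha
  have ha1 : 1 ≤ a := one_le_pow₀ (by linarith)
  have haM : a ≤ M ^ (4 * d) := by
    rw [pow_mul]
    refine pow_le_pow_left₀ (by linarith) ?_ d
    nlinarith [two 3]
  set s : ℝ := 16 * 9 ^ d * a with hs
  have hs1 : 16 ≤ s := by nlinarith
  set t : ℝ := τ / (2 * a * s) with ht
  have ht0 : 0 < t := by positivity
  have ht1 : t ≤ 1 := by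
    rw [ht, div_le_one (by positivity)]
    nlinarith
  have htM : 1 / t ≤ 1 / τ * M ^ (17 * d) := by
    calc 1 / t = 1 / τ * (2 ^ 5 * 9 ^ d * a * a) := by rw [ht, hs]; field_simp; norm_num
      _ ≤ 1 / τ * (M ^ (5 * d) * M ^ (4 * d) * M ^ (4 * d) * M ^ (4 * d)) := by
          have := (two 5).trans (hMp (show 5 ≤ 5 * d by omega))
          gcongr
      _ = _ := by rw [← pow_add, ← pow_add, ← pow_add]; ring_nf
  -- Chosen so that (1-t)^m ≤ e^(-16dM) ≤ M^(-16d), which beats d·b ≤ M^(16d).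
  set m := ⌈16 * d * M / t⌉₊ with hm
  set N := ⌈32 * 9 ^ d * L⌉₊ with hN
  set b : ℝ := 256 * (2 * r - 1) ^ d * 9 ^ d with hb
  have hb0 : 0 < b := by
    have : (0 : ℝ) < 2 * r - 1 := by linarith
    positivity
  have hbM : d * b ≤ M ^ (16 * d) := by
    have h1 : (2 * r - 1 : ℝ) ^ d ≤ M ^ (3 * d) := by
      rw [pow_mul]
      refine pow_le_pow_left₀ (by linarith) ?_ d
      nlinarith [two 2]
    have h2 : (256 : ℝ) ≤ M ^ (8 * d) := by
      have := (two 8).trans (hMp (show 8 ≤ 8 * d by omega))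
      linarith
    have h3 : (d : ℝ) ≤ M ^ d := hdM.trans (by simpa using hMp hd)
    have h4 : (0 : ℝ) ≤ (2 * r - 1) ^ d := pow_nonneg (by linarith) d
    calc d * b ≤ M ^ d * (M ^ (8 * d) * M ^ (3 * d) * M ^ (4 * d)) := by rw [hb]; gcongr
      _ = _ := by rw [← pow_add, ← pow_add, ← pow_add]; ring_nf
  refine ⟨m, r + 1, r, N, t, 1 / b, ht0, ht1, ?_, hr0, hrτ, ?_, by positivity, ?_, ?_, ?_, ?_⟩
  · push_cast
    rw [show 2 * ((r : ℝ) + 1 + 1) - 1 = 2 * r + 3 by ring, ← ha,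
      show 2 * a * t / τ = 1 / s by rw [ht]; field_simp]
    calc (1 / s) ^ (r + 1 + 1) = (1 / s) ^ r * (1 / s) ^ 2 := by ring
      _ ≤ τ * (1 / s) ^ 2 := by
          gcongr
          refine le_trans (pow_le_pow_left₀ (by positivity) ?_ r) hrτ
          exact one_div_le_one_div_of_le (by norm_num) (by linarith)
      _ = t / (8 * 9 ^ d) := by rw [ht, hs]; field_simp; norm_num
  · nlinarith
  · rw [le_div_iff₀ hb0]
    have h1 : (1 - t) ^ m ≤ (M ^ (16 * d))⁻¹ := by
      refine (one_sub_pow_le_exp ht1 m).trans ?_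
      rw [Real.exp_neg]
      refine inv_anti₀ (by positivity) ?_
      calc M ^ (16 * d) ≤ Real.exp M ^ (16 * d) :=
            pow_le_pow_left₀ (by linarith) (by linarith [Real.add_one_le_exp M]) _
        _ = Real.exp (16 * d * M) := by rw [← Real.exp_nat_mul]; push_cast; rfl
        _ ≤ Real.exp (t * m) := by
            refine Real.exp_le_exp.mpr ?_
            have := Nat.le_ceil (16 * d * M / t)
            rw [div_le_iff₀ ht0] at this
            linarith
    calc (1 - t) ^ m * d * b = (1 - t) ^ m * (d * b) := by ring
      _ ≤ (M ^ (16 * d))⁻¹ * M ^ (16 * d) := by gcongr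
      _ = 1 := inv_mul_cancel₀ (by positivity)
  · rw [mul_one_div_cancel hb0.ne']
  · refine (one_sub_pow_le_exp ?_ N).trans ?_
    · rw [div_le_one (by positivity)]; linarith
    · rw [hτL, Real.rpow_def_of_pos (by norm_num)]
      refine Real.exp_le_exp.mpr ?_
      have h1 : L ≤ 1 / (32 * 9 ^ d) * N := by
        rw [one_div, inv_mul_eq_div, le_div_iff₀ (by positivity)]
        linarith [Nat.le_ceil (32 * 9 ^ d * L)]
      nlinarith [Real.log_two_lt_d9]
  · have hm1 : (m : ℝ) ≤ 1 / τ * M ^ (24 * d) := by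
      have h1 : (m : ℝ) ≤ 16 * d * M / t + 1 := (Nat.ceil_lt_add_one (by positivity)).le
      have h2 : 1 ≤ 1 / t := by rw [le_div_iff₀ ht0]; linarith
      have h3 : d * M ≤ M ^ 2 := by
        rw [sq]; exact mul_le_mul_of_nonneg_right hdM (by linarith)
      have h4 : 1 ≤ M ^ 2 := one_le_pow₀ (by linarith)
      calc (m : ℝ) ≤ (16 * d * M + 1) * (1 / t) := by
            rw [add_mul, one_mul, mul_one_div]; linarith
        _ ≤ M ^ (7 * d) * (1 / τ * M ^ (17 * d)) := by
            refine mul_le_mul ?_ htM (by positivity) (by positivity)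
            calc 16 * d * M + 1 = 16 * (d * M) + 1 := by ring
              _ ≤ 2 ^ 5 * M ^ 2 := by nlinarith
              _ ≤ M ^ 5 * M ^ 2 := by gcongr
              _ = M ^ 7 := by ring
              _ ≤ M ^ (7 * d) := hMp (by omega)
        _ = _ := by rw [mul_left_comm, ← pow_add]; ring_nf
    have hN1 : (N : ℝ) ≤ M ^ (11 * d) := by
      have h1 : (N : ℝ) ≤ 32 * 9 ^ d * L + 1 := (Nat.ceil_lt_add_one (by positivity)).le
      have h3 : 9 ^ d * L ≤ 9 ^ d * M := by gcongr
      have h4 : (1 : ℝ) * 1 ≤ 9 ^ d * M := mul_le_mul h9 (by linarith) zero_le_one (by linarith)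
      calc (N : ℝ) ≤ 2 ^ 6 * M * 9 ^ d := by linarith
        _ ≤ M ^ 6 * M * M ^ (4 * d) := by gcongr
        _ = M ^ (7 + 4 * d) := by rw [pow_add]; ring
        _ ≤ M ^ (11 * d) := hMp (by omega)
    -- The exponent 35 is 11 from the rounds plus 24 from the head size, the latter being 7 + 17
    -- with 17 coming from 1/t.
    calc (N * m : ℝ) ≤ M ^ (11 * d) * (1 / τ * M ^ (24 * d)) := by gcongr
      _ = _ := by rw [mul_left_comm, ← pow_add]; ring_nf

end

end KWisePTF

/-! ### The main theorem -/

theorem mainTheorem10 :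
    ∃ C K : ℕ, ∀ (d n : ℕ) (p : MvPolynomial (Fin n) ℝ), p.totalDegree ≤ d →
      ∀ τ : ℝ, 0 < τ →
        ∃ T : KWisePTF.DTree n Finset.univ,
          (T.depth : ℝ) ≤ (1 / τ) * (max 2 ((d : ℝ) * Real.logb 2 (1 / τ))) ^ (C * d) ∧
          (∀ x : KWisePTF.Cube (Fin n), T.eval x = KWisePTF.ptf p x) ∧
          (∀ x : KWisePTF.Cube (Fin n), (T.leafAt x).2.totalDegree ≤ d ∧
            (T.leafAt x).2 = KWisePTF.restrict p (T.leafAt x).1 x) ∧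
          1 - τ ≤ T.walkProb (fun _ q =>
            KWisePTF.IsRegular τ q ∨
              ∀ k : ℕ, (K : ℝ) * ((d : ℝ) * Real.logb 2 (1 / τ)) ≤ (k : ℝ) →
                KWisePTF.IsCloseToConstUnderKWise k τ (KWisePTF.ptf q)) := by
  -- K = 4 because 2rd with r = ⌈L⌉ < L + 1 < 2L is at most 4dL, using L > 1 when τ < 1/2.
  refine ⟨35, 4, fun d n p hp τ hτ => ?_⟩
  have hM : (0 : ℝ) ≤ 1 / τ * (max 2 (d * Real.logb 2 (1 / τ))) ^ (35 * d) := by positivity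
  suffices h : ∃ D : ℕ, (D : ℝ) ≤ 1 / τ * (max 2 (d * Real.logb 2 (1 / τ))) ^ (35 * d) ∧
      KWisePTF.HasTree p
        (fun _ q => KWisePTF.GoodLeaf τ (((4 : ℕ) : ℝ) * (d * Real.logb 2 (1 / τ))) q)
        Finset.univ 1 D (1 - τ) by
    obtain ⟨D, hD, hT⟩ := h
    obtain ⟨T, hTD, he, hl, hw⟩ := hT.exists_tree hp
    exact ⟨T, le_trans (by exact_mod_cast hTD) hD, he, hl, hw⟩
  rcases le_or_gt (1 / 2) τ with hτ2 | hτ2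
  · exact ⟨0, by simpa using hM, KWisePTF.hasTree_leaf (by linarith)
      (Or.inl (Or.inr fun k _ => KWisePTF.isCloseToConst_of_half_le hτ2 _))⟩
  -- In degree 0 all influences vanish, so the single leaf is regular.
  rcases Nat.eq_zero_or_pos d with rfl | hd
  · refine ⟨0, by simpa using hM, KWisePTF.hasTree_leaf (by linarith)
      (Or.inl (Or.inl (KWisePTF.isRegular_restrict fun i _ => ?_)))⟩
    have h := KWisePTF.sum_inf_le (KWisePTF.lowDegree_fixOff hp Finset.univ 1)
    have h0 : ∀ j, 0 ≤ KWisePTF.inf (KWisePTF.fixOff (KWisePTF.evalCube p) Finset.univ 1) j :=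
      fun j => KWisePTF.inf_nonneg _ j
    rw [Nat.cast_zero, zero_mul] at h
    exact ((Finset.single_le_sum (fun j _ => h0 j) (Finset.mem_univ i)).trans h).trans
      (mul_nonneg hτ.le (Finset.sum_nonneg fun j _ => h0 j))
  obtain ⟨m, Q, r, N, τ', η, hτ', hτ1, hQ, hr, hrτ, hrκ, hη, hηm, hηr, hN, hNm⟩ :=
    KWisePTF.exists_parameters hd hτ hτ2
  refine ⟨N * m, by exact_mod_cast hNm, ?_⟩
  have hδ : (1 / (32 * 9 ^ d) : ℝ) ≤ 1 := by
    rw [div_le_one (by positivity)]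
    have : (1 : ℝ) ≤ 9 ^ d := one_le_pow₀ (by norm_num)
    linarith
  -- At the root every variable is free, so the base point 1 is an arbitrary choice.
  obtain ⟨T, hD, hl, hw⟩ := KWisePTF.hasTree_iterate (p := p)
    (P := fun _ q => KWisePTF.GoodLeaf τ (((4 : ℕ) : ℝ) * (d * Real.logb 2 (1 / τ))) q)
    hδ
    (KWisePTF.exists_head hp hτ hτ' hτ1 hQ hr hrτ (by exact_mod_cast hrκ) hη hηm hηr)
    N Finset.univ 1
  exact ⟨T, hD, hl, by linarith⟩
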